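/- Let $N,m\in\mathbb N$ with $m\ge 1$ and let $1<p<\infty$. Let $K\subset\mathbb R^N$ be a convex set with nonempty interior that contains the origin and is symmetric ($K=-K$), and put $\|x\|_K=\inf\{\lambda>0 : x/\lambda\in K\}$. Let $f\in W^{m,p}(\mathbb R^N)$ be real-valued, that is, $f$ and all its weak partial derivatives of order at most $m$ belong to $L^p(\mathbb R^N)$. For $x,y\in\mathbb R^N$ put $$R^mf(x,y)=\sum_{j=0}^m(-1)^j\binom mj f\Big(\frac{m-j}{m}x+\frac jm y\Big),$$ and for a.e. $x$ and all $\sigma\in\mathbb R^N$ $$D^mf(x)(\sigma,\dots,\sigma)=\sum_{1\le i_1,\dots,i_m\le N}\sigma_{i_1}\cdots\sigma_{i_m}\frac{\partial^mf}{\partial x_{i_1}\cdots\partial x_{i_m}}(x),$$ with weak partial derivatives. Then $$\lim_{\delta\to0^+}\ \iint_{\{(x,y)\in\mathbb R^N\times\mathbb R^N\,:\,|R^mf(x,y)|>\delta\}}\frac{\delta^p}{\|x-y\|_K^{N+mp}}\,dx\,dy=\frac{N+mp}{m^{mp+1}\,p}\int_{\mathbb R^N}\int_K|D^mf(x)(y,\dots,y)|^p\,dy\,dx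 .$$ If $K$ is bounded (so that $\|\cdot\|_K$ is a norm), the right-hand side is finite. If $K$ is unbounded, both sides are understood in $[0,\infty]$, with $\delta^p/0=\infty$. -/

import Mathlib

open MeasureTheory Filter Topology
open scoped ENNReal ContDiff

noncomputable section

namespace Nguyen

/-- `ℝ^N` with its Euclidean norm and Lebesgue measure. -/
abbrev Space (N : ℕ) : Type := EuclideanSpace ℝ (Fin N)

/-- The classical partial derivative `∂^k φ / ∂x_{i 0} ⋯ ∂x_{i (k-1)}` of a smooth function. -/
def smoothPartial {N k : ℕ} (i : Fin k → Fin N) (φ : Space N → ℝ) (x : Space N) : ℝ :=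
  iteratedFDeriv ℝ k φ x (fun j => EuclideanSpace.single (i j) (1 : ℝ))

/-- `g` is a weak partial derivative `∂^k f / ∂x_{i 0} ⋯ ∂x_{i (k-1)}` of `f` on `ℝ^N`: both are
locally integrable, and `∫ f ∂_i φ = (-1)^k ∫ g φ` for every test function `φ ∈ C_c^∞(ℝ^N)`. -/
structure HasWeakPartial {N k : ℕ} (i : Fin k → Fin N) (f g : Space N → ℝ) : Prop where
  locallyIntegrable_left : LocallyIntegrable f volume
  locallyIntegrable_right : LocallyIntegrable g volume
  integral_eq : ∀ φ : Space N → ℝ, ContDiff ℝ ∞ φ → HasCompactSupport φ →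
    ∫ x, f x * smoothPartial i φ x = (-1 : ℝ) ^ k * ∫ x, g x * φ x

/-- `f ∈ W^{m,p}(ℝ^N)`: `f` is in `L^p`, and so are all its weak partial derivatives of
order at most `m`. -/
def MemSobolev {N : ℕ} (m : ℕ) (p : ℝ) (f : Space N → ℝ) : Prop :=
  MemLp f (ENNReal.ofReal p) volume ∧
    ∀ k ≤ m, ∀ i : Fin k → Fin N, ∃ g : Space N → ℝ,
      HasWeakPartial i f g ∧ MemLp g (ENNReal.ofReal p) volume

open Classical in
/-- A representative of the weak partial derivative `∂^k f / ∂x_{i 0} ⋯ ∂x_{i (k-1)}`, which is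
unique up to a null set (and `0` if there is none). -/
def weakPartial {N k : ℕ} (i : Fin k → Fin N) (f : Space N → ℝ) : Space N → ℝ :=
  if h : ∃ g, HasWeakPartial i f g then h.choose else 0

theorem HasWeakPartial.weakPartial {N k : ℕ} {i : Fin k → Fin N} {f g : Space N → ℝ}
    (h : HasWeakPartial i f g) : HasWeakPartial i f (weakPartial i f) := by
  have h' : ∃ g, HasWeakPartial i f g := ⟨g, h⟩
  rw [Nguyen.weakPartial, dif_pos h']
  exact h'.choose_spec

/-- `D^k f(x)(σ,…,σ) = ∑_{i_1,…,i_k} σ_{i_1} ⋯ σ_{i_k} ∂^k f / ∂x_{i_1} ⋯ ∂x_{i_k} (x)`. -/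
def weakD {N : ℕ} (k : ℕ) (f : Space N → ℝ) (x σ : Space N) : ℝ :=
  ∑ i : Fin k → Fin N, (∏ j, σ (i j)) * weakPartial i f x

/-- `R^m f(x,y) = ∑_{j=0}^m (-1)^j (m choose j) f((m-j)/m x + j/m y)`, for `m ≥ 1`. -/
def finiteDiff {N : ℕ} (m : ℕ) (f : Space N → ℝ) (x y : Space N) : ℝ :=
  ∑ j ∈ Finset.range (m + 1), (-1 : ℝ) ^ j * (m.choose j : ℝ) *
    f ((((m : ℝ) - (j : ℝ)) / (m : ℝ)) • x + ((j : ℝ) / (m : ℝ)) • y)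

/-- The integral of `δ^p / ‖x - y‖_K^{N+mp}` over the pairs `(x,y)` with `|R^m f(x,y)| > δ`, as
an element of `[0,∞]`. Here `‖x‖_K = inf {r > 0 | x ∈ r K}` is the gauge of `K`, and
`δ^p / 0 = ∞`. -/
def nguyenIntegral {N : ℕ} (K : Set (Space N)) (m : ℕ) (p : ℝ) (f : Space N → ℝ) (δ : ℝ) :
    ℝ≥0∞ :=
  ∫⁻ z in {z : Space N × Space N | δ < |finiteDiff m f z.1 z.2|},
    ENNReal.ofReal (δ ^ p) /
      ENNReal.ofReal (gauge K (z.1 - z.2) ^ ((N : ℝ) + (m : ℝ) * p))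

/-- `∫_{ℝ^N} ∫_K |D^m f(x)(y,…,y)|^p dy dx`, as an element of `[0,∞]`. -/
def anisotropicEnergy {N : ℕ} (K : Set (Space N)) (m : ℕ) (p : ℝ) (f : Space N → ℝ) : ℝ≥0∞ :=
  ∫⁻ x : Space N, ∫⁻ y in K, ENNReal.ofReal (|weakD m f x y| ^ p)

end Nguyen

end

/-! Put `δ = ε^m` and `y = x + mεw`. The nodes in `R^m f(x,y)` become `x + jεw`, and the powers of
`ε` coming from the Jacobian, the gauge and `δ^p` cancel. What remains is `m^(-mp) ∫ |{x : |Δ(x)| >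
ε^m}| ‖w‖_K^(-(N+mp)) dw`, where `Δ` is, up to sign, the `m`-th difference of `f` with step `εw`.

By a weak Taylor formula (`ae_sum_shift_eq_average`), `Δ` is, up to sign, `ε^m` times a B-spline
average of `g_w = D^m f(·)(w,…,w)` over the segment from `x` to `x + mεw`. As `ε → 0` these averages
tend to `g_w` in measure, so the measure of the set tends to `|{|g_w| > 1}|`
(`tendsto_measure_average_gt`) whenever `{|g_w| = 1}` is null; homogeneity in `w` makes this true
for almost every `w` (`addHaar_homogeneous_eq_one`).

The interchange of limit and integral needs no maximal function. Chebyshev's inequality and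
translation invariance bound all these measures by `2 ∫ (|g_w| - 1/2)₊ dx`, whatever `ε` is
(`measure_average_gt_le`). Homogeneity evaluates both the weighted integral of the limit
(`setLIntegral_homogeneous_gauge`) and that of the majorant (`lintegral_tsub_homogeneous_gauge`);
since `p > 1`, the second is a finite multiple of the first. Hence either the majorant is integrable
and dominated convergence applies, or the expected limit is `∞` and Fatou's lemma suffices. -/

namespace Nguyen

/-! ### Averages along a line and the B-spline law -/

section Averaging

variable {E : Type*} [NormedAddCommGroup E] [NormedSpace ℝ E]

/-- The average is the convolution of `φ` with the image of `ν` on the line spanned by `z`: the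
constant `1` is convolved with `φ` with respect to that image measure. -/
theorem contDiff_average [MeasurableSpace E] [BorelSpace E]
    [FiniteDimensional ℝ E] (ν : Measure ℝ) [IsFiniteMeasure ν] {φ : E → ℝ}
    (hφ : ContDiff ℝ ∞ φ) (hφc : HasCompactSupport φ) (z : E) :
    ContDiff ℝ ∞ (fun x => ∫ s, φ (x - s • z) ∂ν) := by
  have hm : Measurable (fun s : ℝ => s • z) := by fun_prop
  have h := hφc.contDiff_convolution_right (n := ⊤) (ContinuousLinearMap.lsmul ℝ ℝ)
    (μ := ν.map (fun s : ℝ => s • z)) (f := fun _ => (1 : ℝ))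
    (continuous_const.locallyIntegrable) hφ
  convert h using 2 with x
  simp only [convolution_def, ContinuousLinearMap.lsmul_apply, one_smul]
  rw [integral_map hm.aemeasurable]
  have : Continuous (fun t => φ (x - t)) := by
    have := hφ.continuous
    fun_prop
  exact this.aestronglyMeasurable

theorem exists_average_support (M : ℝ) {φ : E → ℝ} (hφc : HasCompactSupport φ) (z : E) :
    ∃ R : ℝ, ∀ x, R < ‖x‖ → ∀ s ∈ Set.Icc 0 M, φ (x - s • z) = 0 := by
  obtain ⟨R, hR⟩ := hφc.isCompact.isBounded.exists_norm_le
  refine ⟨R + M * ‖z‖, fun x hx s hs => image_eq_zero_of_notMem_tsupport fun hmem => ?_⟩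
  have h1 := hR _ hmem
  have h2 : ‖x‖ ≤ ‖x - s • z‖ + ‖s • z‖ := by
    simpa using norm_add_le (x - s • z) (s • z)
  rw [norm_smul, Real.norm_of_nonneg hs.1] at h2
  have : s * ‖z‖ ≤ M * ‖z‖ := by gcongr; exact hs.2
  linarith

theorem hasCompactSupport_average [ProperSpace E] {ν : Measure ℝ} {M : ℝ}
    (hν : ∀ᵐ s ∂ν, s ∈ Set.Icc 0 M) {φ : E → ℝ} (hφc : HasCompactSupport φ) (z : E) :
    HasCompactSupport (fun x => ∫ s, φ (x - s • z) ∂ν) := by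
  obtain ⟨R, hR⟩ := exists_average_support M hφc z
  refine HasCompactSupport.intro (isCompact_closedBall (0 : E) R) fun x hx => ?_
  rw [mem_closedBall_zero_iff, not_le] at hx
  refine integral_eq_zero_of_ae ?_
  filter_upwards [hν] with s hs using hR x hx s hs

/-- At `x + t z` the average is the integral of `r ↦ ψ (x + r z)` over `[t - 1, t]`, so the
fundamental theorem of calculus gives the difference of the end values. -/
theorem fderiv_unit_average_apply [MeasurableSpace E] [BorelSpace E] [FiniteDimensional ℝ E]
    {ψ : E → ℝ} (hψ : ContDiff ℝ ∞ ψ) (hψc : HasCompactSupport ψ) (x z : E) :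
    fderiv ℝ (fun x => ∫ s in Set.Icc (0 : ℝ) 1, ψ (x - s • z)) x z = ψ x - ψ (x - z) := by
  have hd : DifferentiableAt ℝ (fun x => ∫ s in Set.Icc (0 : ℝ) 1, ψ (x - s • z)) x :=
    (contDiff_average (volume.restrict (Set.Icc (0 : ℝ) 1)) hψ hψc z).differentiable
      (by simp) x
  have h1 : HasDerivAt (fun t : ℝ => ∫ s in Set.Icc (0 : ℝ) 1, ψ (x + t • z - s • z)) _ 0 :=
    hd.hasFDerivAt.hasLineDerivAt z
  have hc : Continuous (fun r : ℝ => ψ (x + r • z)) := by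
    have := hψ.continuous
    fun_prop
  have key : ∀ t : ℝ, (∫ s in Set.Icc (0 : ℝ) 1, ψ (x + t • z - s • z)) =
      (∫ r in (0 : ℝ)..t, ψ (x + r • z)) - ∫ r in (0 : ℝ)..(t - 1), ψ (x + r • z) := by
    intro t
    rw [integral_Icc_eq_integral_Ioc, ← intervalIntegral.integral_of_le zero_le_one]
    have : ∀ s : ℝ, ψ (x + t • z - s • z) = (fun r : ℝ => ψ (x + r • z)) (t - s) := by
      intro s
      simp [sub_smul, add_sub_assoc]
    simp_rw [this]
    rw [intervalIntegral.integral_comp_sub_left (fun r : ℝ => ψ (x + r • z)), sub_zero,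
      intervalIntegral.integral_interval_sub_left (hc.intervalIntegrable _ _)
      (hc.intervalIntegrable _ _)]
  simp_rw [key] at h1
  have hA : ∀ t, HasDerivAt (fun t : ℝ => ∫ r in (0 : ℝ)..t, ψ (x + r • z)) (ψ (x + t • z)) t :=
    fun t => intervalIntegral.integral_hasDerivAt_right (hc.intervalIntegrable _ _)
      hc.stronglyMeasurable.stronglyMeasurableAtFilter hc.continuousAt
  have h2 := (hA 0).sub ((hA (0 - 1)).comp_sub_const 0 1)
  have := h1.unique h2
  rw [this]
  simp [sub_eq_add_neg]

/-- The law of the sum of `m` independent uniform variables on `[0, 1]`; its density is the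
cardinal B-spline of order `m`. -/
noncomputable def splineMeasure : ℕ → Measure ℝ
  | 0 => Measure.dirac 0
  | m + 1 => ((splineMeasure m).prod (volume.restrict (Set.Icc (0 : ℝ) 1))).map
      (fun q => q.1 + q.2)

instance isProbabilityMeasure_splineMeasure (m : ℕ) : IsProbabilityMeasure (splineMeasure m) := by
  induction m with
  | zero => unfold splineMeasure; infer_instance
  | succ m ih =>
    have : IsProbabilityMeasure (volume.restrict (Set.Icc (0 : ℝ) 1)) := ⟨by simp⟩
    unfold splineMeasure
    exact Measure.isProbabilityMeasure_map (by fun_prop)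

theorem ae_splineMeasure_mem_Icc (m : ℕ) : ∀ᵐ s ∂splineMeasure m, s ∈ Set.Icc (0 : ℝ) m := by
  induction m with
  | zero =>
    unfold splineMeasure
    rw [ae_dirac_iff (by measurability)]
    simp
  | succ m ih =>
    unfold splineMeasure
    have hm : AEMeasurable (fun q : ℝ × ℝ => q.1 + q.2)
      ((splineMeasure m).prod (volume.restrict (Set.Icc (0 : ℝ) 1))) := by fun_prop
    rw [ae_map_iff hm (p := fun s => s ∈ Set.Icc (0 : ℝ) _) measurableSet_Icc]
    have h1 : ∀ᵐ t ∂volume.restrict (Set.Icc (0 : ℝ) 1), t ∈ Set.Icc (0 : ℝ) 1 :=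
      ae_restrict_mem measurableSet_Icc
    filter_upwards [Measure.quasiMeasurePreserving_fst.ae ih,
      Measure.quasiMeasurePreserving_snd.ae h1] with q h2 h3
    simp only [Set.mem_Icc] at *
    push_cast
    constructor <;> linarith [h2.1, h2.2, h3.1, h3.2]

theorem integral_splineMeasure_succ (m : ℕ) {φ : E → ℝ} (hφ : Continuous φ)
    (hφc : HasCompactSupport φ) (x z : E) :
    ∫ s, φ (x - s • z) ∂splineMeasure (m + 1) =
      ∫ t in Set.Icc (0 : ℝ) 1, ∫ s, φ (x - t • z - s • z) ∂splineMeasure m := by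
  conv_lhs => unfold splineMeasure
  rw [integral_map (by fun_prop) (by fun_prop), integral_prod_symm]
  · simp only [add_smul, sub_sub, add_comm]
  · obtain ⟨C, hC⟩ := hφc.exists_bound_of_continuous hφ
    exact Integrable.of_bound (by fun_prop) C (ae_of_all _ fun q => hC _)

/-- Each of the `m` uniform factors of the spline law turns one derivative along `z` into one
difference of `φ`. -/
theorem iteratedFDeriv_average_splineMeasure [MeasurableSpace E] [BorelSpace E]
    [FiniteDimensional ℝ E] (m : ℕ) {φ : E → ℝ} (hφ : ContDiff ℝ ∞ φ)
    (hφc : HasCompactSupport φ) (x z : E) :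
    iteratedFDeriv ℝ m (fun x => ∫ s, φ (x - s • z) ∂splineMeasure m) x (fun _ => z) =
      (-1) ^ m * (fwdDiff (-z))^[m] φ x := by
  have := FiniteDimensional.proper ℝ E
  induction m generalizing φ with
  | zero => simp [splineMeasure]
  | succ m ih =>
    set ψ : E → ℝ := fun x => ∫ s, φ (x - s • z) ∂splineMeasure m with hψdef
    have hψ : ContDiff ℝ ∞ ψ := contDiff_average _ hφ hφc z
    have hψc : HasCompactSupport ψ :=
      hasCompactSupport_average (ae_splineMeasure_mem_Icc m) hφc z
    have e1 : (fun x => ∫ s, φ (x - s • z) ∂splineMeasure (m + 1)) =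
        fun x => ∫ t in Set.Icc (0 : ℝ) 1, ψ (x - t • z) :=
      funext fun x => integral_splineMeasure_succ m hφ.continuous hφc x z
    have hΨ := contDiff_average (volume.restrict (Set.Icc (0 : ℝ) 1)) hψ hψc z
    have hφ' : ContDiff ℝ ∞ (fwdDiff (-z) φ) := by
      unfold fwdDiff
      fun_prop
    have hφc' : HasCompactSupport (fwdDiff (-z) φ) :=
      (hφc.comp_homeomorph (Homeomorph.addRight (-z))).sub hφc
    have e2 : (fun y => fderiv ℝ (fun x => ∫ t in Set.Icc (0 : ℝ) 1, ψ (x - t • z)) y z) =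
        -fun y => ∫ s, fwdDiff (-z) φ (y - s • z) ∂splineMeasure m := by
      funext y
      rw [Pi.neg_apply]
      rw [fderiv_unit_average_apply hψ hψc, hψdef]
      have hi : ∀ y, Integrable (fun s : ℝ => φ (y - s • z)) (splineMeasure m) := fun y => by
        obtain ⟨C, hC⟩ := hφc.exists_bound_of_continuous hφ.continuous
        have := hφ.continuous
        exact Integrable.of_bound (by fun_prop) C (ae_of_all _ fun q => hC _)
      simp only [fwdDiff]
      rw [← integral_sub (hi y) (hi _), ← integral_neg]
      congr 1
      funext s
      rw [neg_sub]
      congr 2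
      abel
    rw [e1, iteratedFDeriv_succ_apply_right]
    -- Evaluating the innermost derivative at `z` commutes with the outer `m` derivatives, so the
    -- induction hypothesis can be used for the difference of `φ`.
    have e3 := iteratedFDeriv_clm_apply_const_apply (n := ∞) (i := m)
      (hΨ.fderiv_right (m := ∞) (by simp)) (by exact_mod_cast le_top) (u := z) (x := x)
      (m := fun _ => z)
    have e4 : (Fin.init fun _ : Fin (m + 1) => z) = fun _ => z := rfl
    rw [e4, ← e3, e2, iteratedFDeriv_neg_apply, neg_apply, ih hφ' hφc',
      Function.iterate_succ_apply]
    ring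

end Averaging

/-! ### Differences as spline averages of weak derivatives -/

section WeakTaylor

theorem locallyIntegrable_comp_add_right {E : Type*} [NormedAddCommGroup E]
    [MeasurableSpace E] [BorelSpace E] {μ : Measure E} [μ.IsAddHaarMeasure] {f : E → ℝ}
    (hf : LocallyIntegrable f μ) (v : E) :
    LocallyIntegrable (fun x => f (x + v)) μ := by
  have h := (locallyIntegrable_map_homeomorph (Homeomorph.addRight v) (f := f) (μ := μ)).1
  rw [Homeomorph.coe_addRight, map_add_right_eq_self] at h
  exact h hf

variable {E : Type*} [NormedAddCommGroup E] [NormedSpace ℝ E] [MeasurableSpace E] [BorelSpace E]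
  [FiniteDimensional ℝ E] {μ : Measure E} [μ.IsAddHaarMeasure]

theorem measurePreserving_prod_shear (ν : Measure ℝ) [SFinite ν] (z : E) :
    MeasurePreserving (fun q : ℝ × E => (q.1, q.2 + q.1 • z)) (ν.prod μ) (ν.prod μ) :=
  (MeasurePreserving.id ν).skew_product (g := fun s x => x + s • z)
    (by unfold Function.uncurry; fun_prop)
    (ae_of_all _ fun s => map_add_right_eq_self μ (s • z))

/-- Local integrability of `g` is enough: `s` stays in `[0, M]`, so only the values of `g` on the
ball of radius `R + M‖z‖` matter. -/
theorem integrable_mul_translate {ν : Measure ℝ} [IsFiniteMeasure ν] {M : ℝ}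
    (hν : ∀ᵐ s ∂ν, s ∈ Set.Icc 0 M) {g : E → ℝ} (hg : LocallyIntegrable g μ) {h : E → ℝ}
    (hm : Measurable h) {C : ℝ} (hC : ∀ x, ‖h x‖ ≤ C) {R : ℝ} (hR : ∀ x, R < ‖x‖ → h x = 0)
    (z : E) : Integrable (fun q : ℝ × E => g q.2 * h (q.2 - q.1 • z)) (ν.prod μ) := by
  have := FiniteDimensional.proper ℝ E
  set B := Metric.closedBall (0 : E) (R + M * ‖z‖)
  have h1 : Integrable (B.indicator g) μ := (integrable_indicator_iff measurableSet_closedBall).2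
    (hg.integrableOn_isCompact (isCompact_closedBall _ _))
  have h2 : Integrable (fun q : ℝ × E => B.indicator g q.2 * h (q.2 - q.1 • z)) (ν.prod μ) :=
    (h1.comp_snd ν).mul_bdd (c := C)
      ((hm.comp (by fun_prop : Measurable fun q : ℝ × E => q.2 - q.1 • z)).aestronglyMeasurable)
      (ae_of_all _ fun q => hC _)
  refine h2.congr ?_
  filter_upwards [Measure.quasiMeasurePreserving_fst.ae hν] with q hq
  by_cases hB : q.2 ∈ B
  · rw [Set.indicator_of_mem hB]
  · have : h (q.2 - q.1 • z) = 0 := by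
      refine hR _ ?_
      rw [mem_closedBall_zero_iff, not_le] at hB
      have h2 : ‖q.2‖ ≤ ‖q.2 - q.1 • z‖ + ‖q.1 • z‖ := by
        simpa using norm_add_le (q.2 - q.1 • z) (q.1 • z)
      rw [norm_smul, Real.norm_of_nonneg hq.1] at h2
      have : q.1 * ‖z‖ ≤ M * ‖z‖ := by gcongr; exact hq.2
      linarith
    rw [this, mul_zero, mul_zero]

theorem integrable_translate_mul {ν : Measure ℝ} [IsFiniteMeasure ν] {M : ℝ}
    (hν : ∀ᵐ s ∂ν, s ∈ Set.Icc 0 M) {g : E → ℝ} (hg : LocallyIntegrable g μ) {h : E → ℝ}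
    (hm : Measurable h) {C : ℝ} (hC : ∀ x, ‖h x‖ ≤ C) {R : ℝ} (hR : ∀ x, R < ‖x‖ → h x = 0)
    (z : E) : Integrable (fun q : ℝ × E => g (q.2 + q.1 • z) * h q.2) (ν.prod μ) := by
  have := (measurePreserving_prod_shear (μ := μ) ν z).integrable_comp_of_integrable
    (integrable_mul_translate hν hg hm hC hR z)
  simpa [Function.comp_def] using this

theorem locallyIntegrable_average {ν : Measure ℝ} [IsFiniteMeasure ν] {M : ℝ}
    (hν : ∀ᵐ s ∂ν, s ∈ Set.Icc 0 M) {g : E → ℝ} (hg : LocallyIntegrable g μ) (z : E) :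
    LocallyIntegrable (fun x => ∫ s, g (x + s • z) ∂ν) μ := by
  have := FiniteDimensional.proper ℝ E
  rw [locallyIntegrable_iff]
  intro k hk
  obtain ⟨R, hR⟩ := hk.isBounded.exists_norm_le
  set B := Metric.closedBall (0 : E) R
  have h1 := integrable_translate_mul hν hg (h := B.indicator fun _ => (1 : ℝ))
    (measurable_const.indicator measurableSet_closedBall) (C := 1) (R := R)
    (fun x => (norm_indicator_le_norm_self _ _).trans (by simp))
    (fun x hx => Set.indicator_of_notMem (by simpa [B] using hx) _) z
  have h2 := h1.integral_prod_right
  have hB : k ⊆ B := fun x hx => mem_closedBall_zero_iff.2 (hR x hx)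
  refine IntegrableOn.mono_set ?_ hB
  refine (integrable_indicator_iff measurableSet_closedBall).1 (h2.congr (ae_of_all _ fun x => ?_))
  by_cases hx : x ∈ Metric.closedBall (0 : E) R
  · simp only [B, Set.indicator_of_mem hx, mul_one]
  · simp only [B, Set.indicator_of_notMem hx, mul_zero, integral_zero]

/-- Averaging forwards is adjoint to averaging backwards: Fubini, then the translation by `s • z`
for each fixed `s`. -/
theorem integral_mul_average {ν : Measure ℝ} [IsFiniteMeasure ν] {M : ℝ}
    (hν : ∀ᵐ s ∂ν, s ∈ Set.Icc 0 M) {g : E → ℝ} (hg : LocallyIntegrable g μ) {φ : E → ℝ}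
    (hφ : Continuous φ) (hφc : HasCompactSupport φ) (z : E) :
    ∫ x, g x * ∫ s, φ (x - s • z) ∂ν ∂μ = ∫ x, φ x * ∫ s, g (x + s • z) ∂ν ∂μ := by
  obtain ⟨C, hC⟩ := hφc.exists_bound_of_continuous hφ
  obtain ⟨R, hR⟩ := hφc.isCompact.isBounded.exists_norm_le
  have hR' : ∀ x, R < ‖x‖ → φ x = 0 := fun x hx =>
    image_eq_zero_of_notMem_tsupport fun h => (hR x h).not_gt hx
  have h1 := integrable_mul_translate hν hg hφ.measurable hC hR' z
  have h2 := integrable_translate_mul hν hg hφ.measurable hC hR' z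
  simp_rw [← integral_const_mul]
  have h3 := integral_integral_swap (f := fun s x => g x * φ (x - s • z)) h1
  have h4 := integral_integral_swap (f := fun s x => g (x + s • z) * φ x) h2
  rw [← h3]
  simp_rw [mul_comm (φ _)]
  rw [← h4]
  congr 1
  funext s
  rw [← integral_add_right_eq_self (μ := μ) (fun x => g x * φ (x - s • z)) (s • z)]
  simp

theorem neg_one_pow_mul_iterate_fwdDiff {E : Type*} [AddCommGroup E] (m : ℕ) (φ : E → ℝ)
    (x z : E) : (-1) ^ m * (fwdDiff z)^[m] φ x =
      ∑ j ∈ Finset.range (m + 1), (-1 : ℝ) ^ j * (m.choose j : ℝ) * φ (x + j • z) := by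
  rw [fwdDiff_iter_eq_sum_shift, Finset.mul_sum]
  refine Finset.sum_congr rfl fun j hj => ?_
  rw [zsmul_eq_mul]
  push_cast
  obtain ⟨i, rfl⟩ := Nat.exists_eq_add_of_le (Nat.lt_succ_iff.1 (Finset.mem_range.1 hj))
  rw [Nat.add_sub_cancel_left, pow_add]
  have : (-1 : ℝ) ^ i * (-1) ^ i = 1 := by rw [← mul_pow]; simp
  linear_combination ((-1 : ℝ) ^ j * ((j + i).choose j : ℝ) * φ (x + j • z)) * this

/-- A function with a weak `m`-th directional derivative `g` along `z` has, almost everywhere,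
`m`-th difference along `z` equal to a B-spline average of `g`. -/
theorem ae_sum_shift_eq_average {m : ℕ} {z : E} {f g : E → ℝ} (hf : LocallyIntegrable f μ)
    (hg : LocallyIntegrable g μ)
    (h : ∀ φ : E → ℝ, ContDiff ℝ ∞ φ → HasCompactSupport φ →
      ∫ x, f x * iteratedFDeriv ℝ m φ x (fun _ => z) ∂μ = (-1 : ℝ) ^ m * ∫ x, g x * φ x ∂μ) :
    ∀ᵐ x ∂μ, ∑ j ∈ Finset.range (m + 1), (-1 : ℝ) ^ j * (m.choose j : ℝ) * f (x + j • z) =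
      (-1) ^ m * ∫ s, g (x + s • z) ∂splineMeasure m := by
  have := FiniteDimensional.proper ℝ E
  have hν := ae_splineMeasure_mem_Icc m
  have hft : ∀ v : E, LocallyIntegrable (fun x => f (x + v)) μ :=
    locallyIntegrable_comp_add_right hf
  have hL : LocallyIntegrable (fun x => ∑ j ∈ Finset.range (m + 1),
      (-1 : ℝ) ^ j * (m.choose j : ℝ) * f (x + j • z)) μ := by
    refine locallyIntegrable_finsetSum _ fun j _ => ?_
    exact (hft (j • z)).smul ((-1 : ℝ) ^ j * (m.choose j : ℝ))
  refine ae_eq_of_integral_contDiff_smul_eq hL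
    ((locallyIntegrable_average hν hg z).smul ((-1 : ℝ) ^ m)) fun φ hφ hφc => ?_
  -- The hypothesis is tested on the backward spline average of `φ`, whose `m`-th derivative along
  -- `z` is an `m`-th difference of `φ`. Passing to adjoints on both sides moves the difference onto
  -- `f` and the average onto `g`.
  have hψ := contDiff_average (splineMeasure m) hφ hφc z
  have hψc := hasCompactSupport_average hν hφc z
  have key := h _ hψ hψc
  simp_rw [iteratedFDeriv_average_splineMeasure m hφ hφc, neg_one_pow_mul_iterate_fwdDiff] at key
  rw [integral_mul_average hν hg hφ.continuous hφc] at key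
  simp only [smul_eq_mul, Finset.mul_sum] at key ⊢
  have e : ∀ x, φ x * ((-1) ^ m * ∫ s, g (x + s • z) ∂splineMeasure m) =
      (-1) ^ m * (φ x * ∫ s, g (x + s • z) ∂splineMeasure m) := fun x => by ring
  simp_rw [e]
  rw [integral_const_mul, ← key]
  have i1 : ∀ u v : E, Integrable (fun x => f (x + u) * φ (x + v)) μ := fun u v => by
    have := (hft u).integrable_smul_left_of_hasCompactSupport
      (g := fun x => φ (x + v)) (by have := hφ.continuous; fun_prop)
      (hφc.comp_homeomorph (Homeomorph.addRight v))
    simpa [mul_comm] using this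
  rw [integral_finsetSum, integral_finsetSum]
  · refine Finset.sum_congr rfl fun j _ => ?_
    rw [← integral_add_right_eq_self (μ := μ)
      (fun x => f x * ((-1) ^ j * (m.choose j : ℝ) * φ (x + j • -z))) (j • z)]
    congr 1
    funext x
    have : x + j • z + j • -z = x := by simp
    rw [this]
    ring
  · intro j _
    convert (i1 0 (j • -z)).const_mul ((-1) ^ j * (m.choose j : ℝ)) using 2 with x
    rw [add_zero]; ring
  · intro j _
    convert (i1 (j • z) 0).const_mul ((-1) ^ j * (m.choose j : ℝ)) using 2 with x
    rw [add_zero]; ring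

end WeakTaylor

/-! ### Convergence in measure of the averages -/

theorem enorm_tsub_le_rpow {p : ℝ} (hp : 1 < p) {a : ℝ≥0∞} (ha : a ≠ 0) {u : ℝ≥0∞}
    (hu : u ≠ ⊤) : u - a ≤ a ^ (1 - p) * u ^ p := by
  rcases le_total u a with h | h
  · simp [tsub_eq_zero_of_le h]
  · have hu0 : u ≠ 0 := fun h0 => ha (le_zero_iff.1 (h0 ▸ h))
    calc u - a ≤ u := tsub_le_self
      _ = u ^ (1 - p) * u ^ p := by
          rw [← ENNReal.rpow_add _ _ hu0 hu, sub_add_cancel, ENNReal.rpow_one]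
      _ ≤ a ^ (1 - p) * u ^ p := by
          refine mul_le_mul' ?_ le_rfl
          rw [← neg_sub p 1, ENNReal.rpow_neg, ENNReal.rpow_neg, ENNReal.inv_le_inv]
          exact ENNReal.rpow_le_rpow h (by linarith)

section AverageConvergence

variable {E : Type*} [NormedAddCommGroup E] [NormedSpace ℝ E] [MeasurableSpace E] [BorelSpace E]
  [FiniteDimensional ℝ E] {μ : Measure E} [μ.IsAddHaarMeasure]

/-- Where the average of `|g|` exceeds `a`, the average of `(|g| - a/2)₊` is at least `a/2`, because
`ν` has mass one. Markov's inequality and translation invariance then give a bound that does not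
depend on `z`. -/
theorem measure_average_gt_le (ν : Measure ℝ) [IsProbabilityMeasure ν] {g : E → ℝ}
    (hg : Measurable g) (z : E) {a : ℝ} (ha : 0 < a) :
    μ {x | a < |∫ s, g (x + s • z) ∂ν|} ≤
      ENNReal.ofReal (2 / a) * ∫⁻ x, (‖g x‖ₑ - ENNReal.ofReal (a / 2)) ∂μ := by
  set b := ENNReal.ofReal (a / 2) with hb
  have hb0 : b ≠ 0 := by simp [hb, ha]
  have hbt : b ≠ ⊤ := ENNReal.ofReal_ne_top
  have hmeas : Measurable (fun q : E × ℝ => ‖g (q.1 + q.2 • z)‖ₑ - b) := by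
    have : Measurable (fun q : E × ℝ => q.1 + q.2 • z) := by fun_prop
    exact (hg.comp this).enorm.sub_const _
  have hsub : {x | a < |∫ s, g (x + s • z) ∂ν|} ⊆
      {x | b ≤ ∫⁻ s, (‖g (x + s • z)‖ₑ - b) ∂ν} := by
    intro x hx
    have h1 : ENNReal.ofReal a ≤ ∫⁻ s, ‖g (x + s • z)‖ₑ ∂ν := by
      refine le_trans ?_ (enorm_integral_le_lintegral_enorm _)
      rw [← ofReal_norm]
      exact ENNReal.ofReal_le_ofReal (le_of_lt hx)
    have h2 : ∫⁻ s, ‖g (x + s • z)‖ₑ ∂ν ≤ b + ∫⁻ s, (‖g (x + s • z)‖ₑ - b) ∂ν := by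
      calc ∫⁻ s, ‖g (x + s • z)‖ₑ ∂ν ≤ ∫⁻ s, (b + (‖g (x + s • z)‖ₑ - b)) ∂ν :=
            lintegral_mono fun s => le_add_tsub
        _ = _ := by rw [lintegral_add_left measurable_const]; simp
    have h3 : ENNReal.ofReal a = b + b := by
      rw [hb, ← ENNReal.ofReal_add (by positivity) (by positivity), add_halves]
    exact (ENNReal.add_le_add_iff_left hbt).1 (h3 ▸ h1.trans h2)
  have h4 : ∫⁻ x, ∫⁻ s, (‖g (x + s • z)‖ₑ - b) ∂ν ∂μ = ∫⁻ x, (‖g x‖ₑ - b) ∂μ := by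
    rw [lintegral_lintegral_swap hmeas.aemeasurable]
    simp_rw [lintegral_add_right_eq_self (μ := μ) (fun x => ‖g x‖ₑ - b)]
    simp
  have h5 := mul_meas_ge_le_lintegral (μ := μ) (hmeas.lintegral_prod_right' (ν := ν)) b
  have h6 : ENNReal.ofReal (2 / a) = b⁻¹ := by
    rw [hb, ← ENNReal.ofReal_inv_of_pos (by positivity), inv_div]
  rw [h6, ← h4]
  refine (measure_mono hsub).trans ?_
  rw [← ENNReal.div_eq_inv_mul, ENNReal.le_div_iff_mul_le (Or.inl hb0) (Or.inl hbt), mul_comm]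
  exact h5

theorem ae_integrable_translate {ν : Measure ℝ} [IsFiniteMeasure ν] {M : ℝ}
    (hν : ∀ᵐ s ∂ν, s ∈ Set.Icc 0 M) {g : E → ℝ} (hg : LocallyIntegrable g μ) (z : E) :
    ∀ᵐ x ∂μ, Integrable (fun s => g (x + s • z)) ν := by
  have h : ∀ n : ℕ, ∀ᵐ x ∂μ, Integrable (fun s => g (x + s • z) *
      (Metric.closedBall (0 : E) n).indicator (fun _ => (1 : ℝ)) x) ν := fun n =>
    (integrable_translate_mul hν hg
      (measurable_const.indicator measurableSet_closedBall) (C := 1) (R := n)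
      (fun x => (norm_indicator_le_norm_self _ _).trans (by simp))
      (fun x hx => Set.indicator_of_notMem (by simpa using hx) _) z).prod_left_ae
  filter_upwards [ae_all_iff.2 h] with x hx
  obtain ⟨n, hn⟩ := exists_nat_ge ‖x‖
  have := hx n
  rwa [Set.indicator_of_mem (mem_closedBall_zero_iff.2 hn), funext fun s => mul_one _] at this

/-- Approximate `g` in `L^p` by a continuous `c` with compact support. Uniform continuity controls
the averages of `c`; the remainder `g - c`, averaged or not, is controlled by
`measure_average_gt_le`. Each of the three errors gets `η / 3`. -/
theorem tendsto_measure_average_sub {ν : Measure ℝ} [IsProbabilityMeasure ν] {M : ℝ}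
    (hν : ∀ᵐ s ∂ν, s ∈ Set.Icc 0 M) {p : ℝ} (hp : 1 < p) {g : E → ℝ} (hgm : Measurable g)
    (hg : MemLp g (ENNReal.ofReal p) μ) (z : E) {ι : Type*} {l : Filter ι}
    {ε : ι → ℝ} (hε : Tendsto ε l (𝓝 0))
    {η : ℝ} (hη : 0 < η) :
    Tendsto (fun n => μ {x | η < |(∫ s, g (x + s • (ε n • z)) ∂ν) - g x|}) l (𝓝 0) := by
  have := FiniteDimensional.proper ℝ E
  have hp1 : (1 : ℝ≥0∞) ≤ ENNReal.ofReal p := by simpa using hp.le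
  have hp0 : 0 < p := by linarith
  rw [ENNReal.tendsto_nhds_zero]
  intro κ hκ
  rcases eq_or_ne κ ⊤ with rfl | hκt
  · simp
  set b := ENNReal.ofReal (η / 3 / 2) with hb
  have hb0 : b ≠ 0 := by simp [hb, hη]
  -- `A` collects the constants of the two Chebyshev bounds, so an `L^p` error whose `p`-th power is
  -- at most `κ / A` costs at most `κ` in measure.
  set A : ℝ≥0∞ := 2 * (ENNReal.ofReal (2 / (η / 3)) * b ^ (1 - p)) with hA
  have hAt : A ≠ ⊤ := by
    refine ENNReal.mul_ne_top (by simp) (ENNReal.mul_ne_top ENNReal.ofReal_ne_top ?_)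
    exact ENNReal.rpow_ne_top_of_nonneg' (pos_iff_ne_zero.2 hb0) ENNReal.ofReal_ne_top
  have hd : (κ / A) ^ (1 / p) ≠ 0 := by
    simp [ENNReal.rpow_eq_zero_iff, ENNReal.div_eq_zero_iff, hκ.ne', hAt, hp0.not_gt]
  obtain ⟨c, hcc, hcn, hc, hcL⟩ :=
    hg.exists_hasCompactSupport_eLpNorm_sub_le ENNReal.ofReal_ne_top hd
  have hrm : Measurable (g - c) := hgm.sub hc.measurable
  have hX : ∫⁻ x, (‖(g - c) x‖ₑ - b) ∂μ ≤ b ^ (1 - p) * (κ / A) := by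
    calc ∫⁻ x, (‖(g - c) x‖ₑ - b) ∂μ ≤ ∫⁻ x, b ^ (1 - p) * ‖(g - c) x‖ₑ ^ p ∂μ :=
          lintegral_mono fun x => enorm_tsub_le_rpow hp hb0 (by simp)
      _ = b ^ (1 - p) * ∫⁻ x, ‖(g - c) x‖ₑ ^ p ∂μ :=
          lintegral_const_mul _ (hrm.enorm.pow_const _)
      _ ≤ b ^ (1 - p) * (κ / A) := by
          gcongr
          rw [eLpNorm_eq_lintegral_rpow_enorm_toReal (by simpa using hp0) ENNReal.ofReal_ne_top,
            ENNReal.toReal_ofReal hp0.le, ENNReal.rpow_le_rpow_iff (by positivity)] at hcn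
          exact hcn
  obtain ⟨d, hd0, hd⟩ := Metric.uniformContinuous_iff.1
    (hcc.uniformContinuous_of_continuous hc) (η / 3) (by positivity)
  have hev : ∀ᶠ n in l, M * (|ε n| * ‖z‖) < d := by
    have : Tendsto (fun n => M * (|ε n| * ‖z‖)) l (𝓝 (M * (|0| * ‖z‖))) :=
      (hε.abs.mul_const _).const_mul _
    simp only [abs_zero, zero_mul, mul_zero] at this
    exact this.eventually (gt_mem_nhds hd0)
  filter_upwards [hev] with n hn
  set zn := ε n • z with hzn
  have hmid : ∀ x, |(∫ s, c (x + s • zn) ∂ν) - c x| ≤ η / 3 := by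
    intro x
    have hi : Integrable (fun s => c (x + s • zn)) ν := by
      obtain ⟨C, hC⟩ := hcc.exists_bound_of_continuous hc
      exact Integrable.of_bound (by fun_prop) C (ae_of_all _ fun q => hC _)
    have e : (∫ s, c (x + s • zn) ∂ν) - c x = ∫ s, (c (x + s • zn) - c x) ∂ν := by
      rw [integral_sub hi (integrable_const _)]; simp
    rw [e, ← Real.norm_eq_abs]
    refine (norm_integral_le_of_norm_le_const (C := η / 3) ?_).trans (by simp)
    filter_upwards [hν] with s hs
    rw [← dist_eq_norm]
    refine (hd ?_).le
    rw [dist_eq_norm, add_sub_cancel_left, hzn, norm_smul, norm_smul,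
      Real.norm_of_nonneg hs.1, Real.norm_eq_abs]
    refine lt_of_le_of_lt ?_ hn
    gcongr
    exact hs.2
  -- The unaveraged remainder is written as an average with `z = 0`, so that one bound serves both
  -- terms.
  have hsub : ∀ᵐ x ∂μ, x ∈ {x | η < |(∫ s, g (x + s • zn) ∂ν) - g x|} →
      x ∈ {x | η / 3 < |∫ s, (g - c) (x + s • zn) ∂ν|} ∪
        {x | η / 3 < |∫ s, (g - c) (x + s • (0 : E)) ∂ν|} := by
    filter_upwards [ae_integrable_translate hν (hg.locallyIntegrable hp1) zn,
      ae_integrable_translate hν (hcL.locallyIntegrable hp1) zn] with x h1 h2 hx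
    by_contra hcon
    simp only [Set.mem_union, Set.mem_ofPred_eq, not_or, not_lt, Pi.sub_apply, smul_zero,
      add_zero, integral_const, probReal_univ, one_smul] at hcon hx
    rw [integral_sub h1 h2] at hcon
    have h3 := hmid x
    rw [abs_le] at h3
    have h4 := abs_le.1 hcon.1
    have h5 := abs_le.1 hcon.2
    refine hx.not_ge (abs_le.2 ⟨?_, ?_⟩) <;> linarith [h3.1, h3.2, h4.1, h4.2, h5.1, h5.2]
  have hη3 : 0 < η / 3 := by positivity
  calc μ {x | η < |(∫ s, g (x + s • zn) ∂ν) - g x|}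
      ≤ μ ({x | η / 3 < |∫ s, (g - c) (x + s • zn) ∂ν|} ∪
        {x | η / 3 < |∫ s, (g - c) (x + s • (0 : E)) ∂ν|}) := measure_mono_ae hsub
    _ ≤ _ := measure_union_le _ _
    _ ≤ _ := add_le_add (measure_average_gt_le ν hrm zn hη3) (measure_average_gt_le ν hrm 0 hη3)
    _ ≤ ENNReal.ofReal (2 / (η / 3)) * (b ^ (1 - p) * (κ / A)) +
        ENNReal.ofReal (2 / (η / 3)) * (b ^ (1 - p) * (κ / A)) := by gcongr
    _ = A * (κ / A) := by rw [hA]; ring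
    _ ≤ κ := ENNReal.mul_div_le

/-- Up to a set of vanishing measure, `{|h n| > 1}` lies between `{|g| > 1 + η}` and `{|g| > 1 -
η}`. As `η → 0` the measures of both tend to that of `{|g| > 1}`: the outer one by finiteness and
because the level `1` is null. -/
theorem tendsto_measure_gt_of_tendsto_measure_sub {α : Type*} [MeasurableSpace α]
    {μ : Measure α} {g : α → ℝ} (hgm : Measurable g) (hfin : ∀ a > 0, μ {x | a < |g x|} ≠ ⊤)
    (hone : μ {x | |g x| = 1} = 0) {ι : Type*} {l : Filter ι} {h : ι → α → ℝ}
    (hh : ∀ η > 0, Tendsto (fun n => μ {x | η < |h n x - g x|}) l (𝓝 0)) :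
    Tendsto (fun n => μ {x | 1 < |h n x|}) l (𝓝 (μ {x | 1 < |g x|})) := by
  -- The shift by `2` keeps `1 - η` positive even for `k = 0`, as `hfin` requires.
  have hη : ∀ k : ℕ, 0 < 1 / ((k : ℝ) + 2) := fun k => by positivity
  have hη1 : ∀ k : ℕ, 1 / ((k : ℝ) + 2) < 1 := fun k => by
    rw [div_lt_one (by positivity)]; linarith [(Nat.cast_nonneg k : (0 : ℝ) ≤ k)]
  have hanti : Antitone (fun k : ℕ => 1 / ((k : ℝ) + 2)) := fun i j hij => by
    have : (i : ℝ) ≤ j := by exact_mod_cast hij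
    dsimp only
    gcongr
  have hlim : ∀ t : ℝ, 0 < t → ∃ k : ℕ, 1 / ((k : ℝ) + 2) < t := fun t ht => by
    obtain ⟨k, hk⟩ := exists_nat_one_div_lt ht
    refine ⟨k, lt_of_le_of_lt ?_ hk⟩
    gcongr
    norm_num
  have hup : Tendsto (fun k : ℕ => μ {x | 1 + 1 / ((k : ℝ) + 2) < |g x|}) atTop
      (𝓝 (μ {x | 1 < |g x|})) := by
    have e : {x | 1 < |g x|} = ⋃ k : ℕ, {x | 1 + 1 / ((k : ℝ) + 2) < |g x|} := by
      ext x
      simp only [Set.mem_ofPred_eq, Set.mem_iUnion]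
      constructor
      · intro hx
        obtain ⟨k, hk⟩ := hlim (|g x| - 1) (by linarith)
        exact ⟨k, by linarith⟩
      · rintro ⟨k, hk⟩
        linarith [hη k]
    rw [e]
    refine tendsto_measure_iUnion_atTop fun i j hij x hx => ?_
    rw [Set.mem_ofPred_eq] at hx ⊢
    have := hanti hij
    dsimp only at this
    linarith
  have hdown : Tendsto (fun k : ℕ => μ {x | 1 - 1 / ((k : ℝ) + 2) < |g x|}) atTop
      (𝓝 (μ {x | 1 < |g x|})) := by
    have e : μ {x | 1 < |g x|} = μ (⋂ k : ℕ, {x | 1 - 1 / ((k : ℝ) + 2) < |g x|}) := by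
      have e1 : (⋂ k : ℕ, {x | 1 - 1 / ((k : ℝ) + 2) < |g x|}) =
          {x | 1 < |g x|} ∪ {x | |g x| = 1} := by
        ext x
        simp only [Set.mem_ofPred_eq, Set.mem_iInter, Set.mem_union]
        constructor
        · intro hx
          by_contra! hcon
          obtain ⟨k, hk⟩ := hlim (1 - |g x|) (by have := lt_of_le_of_ne hcon.1 hcon.2; linarith)
          linarith [hx k]
        · rintro (hx | hx) k <;> linarith [hη k]
      rw [e1]
      refine le_antisymm (measure_mono Set.subset_union_left)
        ((measure_union_le _ _).trans (by simp [hone]))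
    rw [e]
    refine tendsto_measure_iInter_atTop
      (fun k => (measurableSet_lt measurable_const hgm.abs).nullMeasurableSet)
      (fun i j hij x hx => ?_) ⟨0, hfin _ (by linarith [hη1 0])⟩
    rw [Set.mem_ofPred_eq] at hx ⊢
    have := hanti hij
    dsimp only at this
    linarith
  rw [tendsto_order]
  constructor
  · intro a ha
    obtain ⟨k, hk⟩ := (hup.eventually (lt_mem_nhds ha)).exists
    have ht := ENNReal.Tendsto.sub (tendsto_const_nhds (x := μ {x | 1 + 1 / ((k : ℝ) + 2) < |g x|}))
      (hh _ (hη k)) (Or.inr (by simp))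
    rw [tsub_zero] at ht
    filter_upwards [ht.eventually (lt_mem_nhds hk)] with n hn
    refine hn.trans_le (tsub_le_iff_right.2 (le_trans (measure_mono fun x hx => ?_)
      (measure_union_le _ _)))
    by_contra hcon
    simp only [Set.mem_union, Set.mem_ofPred_eq, not_or, not_lt] at hcon hx
    have := abs_sub_abs_le_abs_sub (g x) (h n x)
    rw [abs_sub_comm] at this
    linarith [hcon.1, hcon.2]
  · intro b hb
    obtain ⟨k, hk⟩ := (hdown.eventually (gt_mem_nhds hb)).exists
    have ht := (tendsto_const_nhds (x := μ {x | 1 - 1 / ((k : ℝ) + 2) < |g x|})).add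
      (hh _ (hη k))
    rw [add_zero] at ht
    filter_upwards [ht.eventually (gt_mem_nhds hk)] with n hn
    refine lt_of_le_of_lt (le_trans (measure_mono fun x hx => ?_) (measure_union_le _ _)) hn
    by_contra hcon
    simp only [Set.mem_union, Set.mem_ofPred_eq, not_or, not_lt] at hcon hx
    have := abs_sub_abs_le_abs_sub (h n x) (g x)
    linarith [hcon.1, hcon.2]

theorem tendsto_measure_average_gt {ν : Measure ℝ} [IsProbabilityMeasure ν] {M : ℝ}
    (hν : ∀ᵐ s ∂ν, s ∈ Set.Icc 0 M) {p : ℝ} (hp : 1 < p) {g : E → ℝ} (hgm : Measurable g)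
    (hg : MemLp g (ENNReal.ofReal p) μ) (z : E) {ι : Type*} {l : Filter ι}
    {ε : ι → ℝ} (hε : Tendsto ε l (𝓝 0))
    (hone : μ {x | |g x| = 1} = 0) :
    Tendsto (fun n => μ {x | 1 < |∫ s, g (x + s • (ε n • z)) ∂ν|}) l
      (𝓝 (μ {x | 1 < |g x|})) := by
  refine tendsto_measure_gt_of_tendsto_measure_sub hgm (fun a ha => ?_) hone fun η hη =>
    tendsto_measure_average_sub hν hp hgm hg z hε hη
  have hlt := hg.meas_ge_lt_top' (by simpa using by linarith) ENNReal.ofReal_ne_top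
    (ε := ENNReal.ofReal a) (by simpa using ha)
  refine ((measure_mono fun x hx => ?_).trans_lt hlt).ne
  rw [Set.mem_ofPred_eq, ← enorm_eq_nnnorm, ← ofReal_norm]
  exact ENNReal.ofReal_le_ofReal (le_of_lt hx)

end AverageConvergence

/-! ### Homogeneous functions integrated against powers of the gauge -/

theorem lintegral_Ioi_rpow_of_pos {q : ℝ} (hq : 0 < q) {a : ℝ} (ha : 0 < a) :
    ∫⁻ r in Set.Ioi a, ENNReal.ofReal (q * r ^ (-q - 1)) = (ENNReal.ofReal (a ^ q))⁻¹ := by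
  rw [← ofReal_integral_eq_lintegral_ofReal, integral_const_mul,
    integral_Ioi_rpow_of_lt (by linarith) ha, ← ENNReal.ofReal_inv_of_pos (by positivity)]
  · congr 1
    rw [sub_add_cancel, Real.rpow_neg ha.le]
    field_simp
  · exact (integrableOn_Ioi_rpow_of_lt (by linarith) ha).const_mul q
  · filter_upwards [ae_restrict_mem measurableSet_Ioi] with r hr
    have : 0 < r := ha.trans hr
    positivity

/-- At `a = 0` both sides are `∞`. This covers the directions where the gauge of an unbounded `K`
vanishes. -/
theorem lintegral_Ioi_rpow {q : ℝ} (hq : 0 < q) {a : ℝ} (ha : 0 ≤ a) :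
    ∫⁻ r in Set.Ioi a, ENNReal.ofReal (q * r ^ (-q - 1)) = (ENNReal.ofReal (a ^ q))⁻¹ := by
  rcases ha.eq_or_lt with rfl | ha
  · rw [Real.zero_rpow hq.ne', ENNReal.ofReal_zero, ENNReal.inv_zero, ← ENNReal.inv_eq_zero,
      ← nonpos_iff_eq_zero]
    have ht : Tendsto (fun b : ℝ => ENNReal.ofReal (b ^ q)) (𝓝[>] 0) (𝓝 0) := by
      have : ContinuousAt (fun b : ℝ => ENNReal.ofReal (b ^ q)) 0 :=
        ENNReal.continuous_ofReal.continuousAt.comp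
          (Real.continuousAt_rpow_const 0 q (Or.inr hq.le))
      have h := this.tendsto.mono_left (nhdsWithin_le_nhds (s := Set.Ioi 0))
      simpa [Real.zero_rpow hq.ne'] using h
    refine ge_of_tendsto ht ?_
    filter_upwards [self_mem_nhdsWithin] with b hb
    rw [← inv_inv (ENNReal.ofReal (b ^ q)), ENNReal.inv_le_inv, ← lintegral_Ioi_rpow_of_pos hq hb]
    exact lintegral_mono_set (Set.Ioi_subset_Ioi (le_of_lt hb))
  · exact lintegral_Ioi_rpow_of_pos hq ha

section Homogeneous

variable {E : Type*} [NormedAddCommGroup E] [NormedSpace ℝ E] [MeasurableSpace E] [BorelSpace E]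
  [FiniteDimensional ℝ E] {μ : Measure E} [μ.IsAddHaarMeasure]

theorem addHaar_eq_rpow_mul_preimage_smul {r : ℝ} (hr : 0 < r) (s : Set E) :
    μ s = ENNReal.ofReal (r ^ (Module.finrank ℝ E : ℝ)) * μ ((fun x => r • x) ⁻¹' s) := by
  rw [Measure.addHaar_preimage_smul μ hr.ne', ← mul_assoc,
    ← ENNReal.ofReal_mul (by positivity), Real.rpow_natCast, abs_of_pos (by positivity),
    mul_inv_cancel₀ (by positivity), ENNReal.ofReal_one, one_mul]

/-- Polar coordinates without a sphere: write the weight as the integral of `q r^(-q-1)` over `r >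
gauge K w`, exchange the integrals, and dilate each slice by `r`. The slice becomes `{r^m P > 1}`
inside the unit gauge ball, and integrating in `r` first produces `P^p`. -/
theorem setLIntegral_homogeneous_gauge {K : Set E} (hK : Convex ℝ K) (hK0 : K ∈ 𝓝 0) {m : ℕ}
    (hm : 1 ≤ m) {p : ℝ} (hp : 0 < p) {P : E → ℝ} (hPm : Measurable P) (hP0 : ∀ w, 0 ≤ P w)
    (hP : ∀ r > 0, ∀ w, P (r • w) = r ^ m * P w) :
    ∫⁻ w in {w | 1 < P w}, (ENNReal.ofReal (gauge K w ^ ((Module.finrank ℝ E : ℝ) + m * p)))⁻¹ ∂μ =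
      ENNReal.ofReal (((Module.finrank ℝ E : ℝ) + m * p) / (m * p)) *
        ∫⁻ y in K, ENNReal.ofReal (P y ^ p) ∂μ := by
  have hm0 : (0 : ℝ) < m := by exact_mod_cast hm
  set q : ℝ := (Module.finrank ℝ E : ℝ) + m * p with hq
  have hmp : 0 < m * p := by positivity
  have hq0 : 0 < q := by positivity
  have hgm : Measurable (gauge K) := (continuous_gauge hK hK0).measurable
  have hinner : ∀ y, ∫⁻ r in Set.Ioi (0 : ℝ), {r : ℝ | 1 < r ^ m * P y}.indicator
      (fun r => ENNReal.ofReal (q * r ^ (-(m * p) - 1))) r =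
      ENNReal.ofReal (q / (m * p)) * ENNReal.ofReal (P y ^ p) := by
    intro y
    rcases (hP0 y).eq_or_lt with h | h
    · simp only [← h, mul_zero, Real.zero_rpow hp.ne', ENNReal.ofReal_zero]
      have : {r : ℝ | (1 : ℝ) < 0} = ∅ := by ext; simp
      simp [this]
    -- `b` is the radius at which `r ^ m * P y` reaches `1`.
    · set b := P y ^ (-(m : ℝ)⁻¹) with hb
      have hb0 : 0 < b := by positivity
      have hbm : b ^ m * P y = 1 := by
        rw [hb, ← Real.rpow_natCast, ← Real.rpow_mul h.le, neg_mul,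
          inv_mul_cancel₀ hm0.ne', Real.rpow_neg_one, inv_mul_cancel₀ h.ne']
      have hset : {r : ℝ | 1 < r ^ m * P y} ∩ Set.Ioi 0 = Set.Ioi b := by
        ext r
        simp only [Set.mem_inter_iff, Set.mem_ofPred_eq, Set.mem_Ioi]
        constructor
        · rintro ⟨h1, h2⟩
          rw [← hbm] at h1
          exact lt_of_pow_lt_pow_left₀ m h2.le (lt_of_mul_lt_mul_right h1 h.le)
        · intro h1
          refine ⟨?_, hb0.trans h1⟩
          rw [← hbm]
          have := pow_lt_pow_left₀ h1 hb0.le (by omega : m ≠ 0)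
          gcongr
      have hms : MeasurableSet {r : ℝ | 1 < r ^ m * P y} :=
        measurableSet_lt measurable_const (by fun_prop)
      rw [lintegral_indicator hms, Measure.restrict_restrict hms, hset]
      have e : ∀ r : ℝ, ENNReal.ofReal (q * r ^ (-(m * p) - 1)) =
          ENNReal.ofReal (q / (m * p)) * ENNReal.ofReal (m * p * r ^ (-(m * p) - 1)) := by
        intro r
        rw [← ENNReal.ofReal_mul (by positivity)]
        congr 1
        field_simp
      simp_rw [e]
      rw [lintegral_const_mul _ (by fun_prop), lintegral_Ioi_rpow_of_pos hmp hb0,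
        ← ENNReal.ofReal_inv_of_pos (by positivity)]
      congr 2
      rw [hb, ← Real.rpow_mul h.le, ← Real.rpow_neg h.le]
      congr 1
      field_simp
  have hslice : ∀ r > 0, μ ({w | 1 < P w} ∩ {w | gauge K w < r}) =
      ENNReal.ofReal (r ^ (Module.finrank ℝ E : ℝ)) * μ ({w | 1 < r ^ m * P w} ∩ interior K) := by
    intro r hr
    rw [addHaar_eq_rpow_mul_preimage_smul (μ := μ) hr, ← setOfPred_gauge_lt_one_eq_interior hK hK0]
    congr 2
    ext w
    simp only [Set.mem_preimage, Set.mem_inter_iff, Set.mem_ofPred_eq, hP r hr,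
      gauge_smul_of_nonneg hr.le, smul_eq_mul]
    rw [mul_lt_iff_lt_one_right hr]
  have hA : MeasurableSet {w | 1 < P w} := measurableSet_lt measurable_const hPm
  calc ∫⁻ w in {w | 1 < P w}, (ENNReal.ofReal (gauge K w ^ q))⁻¹ ∂μ
      = ∫⁻ w in {w | 1 < P w}, ∫⁻ r in Set.Ioi (0 : ℝ), {r : ℝ | gauge K w < r}.indicator
          (fun r => ENNReal.ofReal (q * r ^ (-q - 1))) r ∂volume ∂μ := by
        refine lintegral_congr fun w => ?_
        have hs : MeasurableSet {r : ℝ | gauge K w < r} := measurableSet_Ioi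
        rw [lintegral_indicator hs, Measure.restrict_restrict hs,
          ← lintegral_Ioi_rpow hq0 (gauge_nonneg w)]
        congr 2
        ext r
        simp only [Set.mem_inter_iff, Set.mem_ofPred_eq, Set.mem_Ioi]
        exact ⟨fun h => ⟨h, (gauge_nonneg w).trans_lt h⟩, fun h => h.1⟩
    _ = ∫⁻ r in Set.Ioi (0 : ℝ), ∫⁻ w in {w | 1 < P w}, {r : ℝ | gauge K w < r}.indicator
          (fun r => ENNReal.ofReal (q * r ^ (-q - 1))) r ∂μ := by
        refine lintegral_lintegral_swap (Measurable.aemeasurable ?_)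
        have : Measurable ({z : E × ℝ | gauge K z.1 < z.2}.indicator
            (fun z : E × ℝ => ENNReal.ofReal (q * z.2 ^ (-q - 1)))) :=
          Measurable.indicator (by fun_prop)
            (measurableSet_lt (hgm.comp measurable_fst) measurable_snd)
        exact this
    _ = ∫⁻ r in Set.Ioi (0 : ℝ), ∫⁻ y in interior K, {r : ℝ | 1 < r ^ m * P y}.indicator
          (fun r => ENNReal.ofReal (q * r ^ (-(m * p) - 1))) r ∂μ := by
        refine setLIntegral_congr_fun measurableSet_Ioi fun r hr => ?_
        rw [Set.mem_Ioi] at hr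
        have h1 : ∀ c : ℝ≥0∞, ∀ w, {r : ℝ | gauge K w < r}.indicator (fun _ => c) r =
            {w | gauge K w < r}.indicator (fun _ => c) w := fun c w => by
          simp [Set.indicator_apply]
        have h2 : ∀ c : ℝ≥0∞, ∀ w, {r : ℝ | 1 < r ^ m * P w}.indicator (fun _ => c) r =
            {w | 1 < r ^ m * P w}.indicator (fun _ => c) w := fun c w => by
          simp [Set.indicator_apply]
        have h3 : ∀ w, {r : ℝ | gauge K w < r}.indicator
            (fun r => ENNReal.ofReal (q * r ^ (-q - 1))) r = {w | gauge K w < r}.indicator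
            (fun _ => ENNReal.ofReal (q * r ^ (-q - 1))) w := fun w => by
          simp [Set.indicator_apply]
        have h4 : ∀ w, {r : ℝ | 1 < r ^ m * P w}.indicator
            (fun r => ENNReal.ofReal (q * r ^ (-(m * p) - 1))) r =
            {w | 1 < r ^ m * P w}.indicator
            (fun _ => ENNReal.ofReal (q * r ^ (-(m * p) - 1))) w := fun w => by
          simp [Set.indicator_apply]
        have hs1 : MeasurableSet {w | gauge K w < r} := measurableSet_lt hgm measurable_const
        have hs2 : MeasurableSet {w | 1 < r ^ m * P w} :=
          measurableSet_lt measurable_const (by fun_prop)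
        simp_rw [h3, h4]
        rw [lintegral_indicator_const hs1, lintegral_indicator_const hs2,
          Measure.restrict_apply hs1, Measure.restrict_apply hs2, Set.inter_comm, hslice r hr,
          ← mul_assoc, ← ENNReal.ofReal_mul (by positivity)]
        congr 2
        rw [mul_assoc, ← Real.rpow_add hr]
        congr 2
        rw [hq]
        ring
    _ = ∫⁻ y in interior K, ∫⁻ r in Set.Ioi (0 : ℝ), {r : ℝ | 1 < r ^ m * P y}.indicator
          (fun r => ENNReal.ofReal (q * r ^ (-(m * p) - 1))) r ∂volume ∂μ := by
        refine lintegral_lintegral_swap (Measurable.aemeasurable ?_)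
        have : Measurable ({z : ℝ × E | 1 < z.1 ^ m * P z.2}.indicator
            (fun z : ℝ × E => ENNReal.ofReal (q * z.1 ^ (-(m * p) - 1)))) :=
          Measurable.indicator (by fun_prop) (measurableSet_lt measurable_const (by fun_prop))
        exact this
    _ = ∫⁻ y in interior K, ENNReal.ofReal (q / (m * p)) * ENNReal.ofReal (P y ^ p) ∂μ :=
        lintegral_congr hinner
    _ = _ := by
        rw [lintegral_const_mul _ (by fun_prop)]
        congr 1
        -- The open gauge ball is the interior of `K`, and the frontier of a convex set is null.
        refine setLIntegral_congr ?_
        exact interior_ae_eq_of_null_frontier (hK.addHaar_frontier μ)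

/-- Layer cake: `(P - a)₊` is the integral of `1_{t < P}` over `t > a`. The previous lemma for `P /
t` gives each level the weight `t^(-p)` times a fixed integral, and `t^(-p)` is integrable at
infinity since `p > 1`. -/
theorem lintegral_tsub_homogeneous_gauge {K : Set E} (hK : Convex ℝ K) (hK0 : K ∈ 𝓝 0) {m : ℕ}
    (hm : 1 ≤ m) {p : ℝ} (hp : 1 < p) {P : E → ℝ} (hPm : Measurable P) (hP0 : ∀ w, 0 ≤ P w)
    (hP : ∀ r > 0, ∀ w, P (r • w) = r ^ m * P w) {a : ℝ} (ha : 0 < a) :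
    ∫⁻ w, (ENNReal.ofReal (P w) - ENNReal.ofReal a) *
      (ENNReal.ofReal (gauge K w ^ ((Module.finrank ℝ E : ℝ) + m * p)))⁻¹ ∂μ =
      ENNReal.ofReal (p - 1)⁻¹ * (ENNReal.ofReal (a ^ (p - 1)))⁻¹ *
      (ENNReal.ofReal (((Module.finrank ℝ E : ℝ) + m * p) / (m * p)) *
        ∫⁻ y in K, ENNReal.ofReal (P y ^ p) ∂μ) := by
  set q : ℝ := (Module.finrank ℝ E : ℝ) + m * p with hq
  set κ : E → ℝ≥0∞ := fun w => (ENNReal.ofReal (gauge K w ^ q))⁻¹ with hκ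
  set I : ℝ≥0∞ := ENNReal.ofReal (q / (m * p)) * ∫⁻ y in K, ENNReal.ofReal (P y ^ p) ∂μ
  have hgm : Measurable (gauge K) := (continuous_gauge hK hK0).measurable
  have hκm : Measurable κ := (hgm.pow_const q).ennreal_ofReal.inv
  have hlevel : ∀ t > 0, ∫⁻ w in {w | t < P w}, κ w ∂μ = ENNReal.ofReal (t ^ (-p)) * I := by
    intro t ht
    have h := setLIntegral_homogeneous_gauge (μ := μ) hK hK0 hm (by linarith : 0 < p)
      (P := fun w => P w / t) (by fun_prop) (fun w => div_nonneg (hP0 w) ht.le)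
      (fun r hr w => by rw [hP r hr]; ring)
    have e1 : {w | 1 < P w / t} = {w | t < P w} := by
      ext w
      simp [one_lt_div ht]
    have e2 : ∀ y, ENNReal.ofReal ((P y / t) ^ p) =
        ENNReal.ofReal (t ^ (-p)) * ENNReal.ofReal (P y ^ p) := fun y => by
      rw [← ENNReal.ofReal_mul (by positivity), Real.div_rpow (hP0 y) ht.le, Real.rpow_neg ht.le]
      congr 1
      field_simp
    simp_rw [e1, e2] at h
    rw [h, lintegral_const_mul _ (by fun_prop)]
    simp only [I]
    ring
  have hms : MeasurableSet {z : E × ℝ | z.2 < P z.1} :=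
    measurableSet_lt measurable_snd (hPm.comp measurable_fst)
  calc ∫⁻ w, (ENNReal.ofReal (P w) - ENNReal.ofReal a) * κ w ∂μ
      = ∫⁻ w, ∫⁻ t in Set.Ioi a, {z : E × ℝ | z.2 < P z.1}.indicator (fun z => κ z.1) (w, t)
          ∂volume ∂μ := by
        refine lintegral_congr fun w => ?_
        have h1 : ∀ t, {z : E × ℝ | z.2 < P z.1}.indicator (fun z => κ z.1) (w, t) =
            (Set.Iio (P w)).indicator (fun _ => κ w) t := fun t => by
          simp [Set.indicator_apply]
        simp_rw [h1]
        rw [lintegral_indicator_const measurableSet_Iio, Measure.restrict_apply measurableSet_Iio,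
          Set.Iio_inter_Ioi, Real.volume_Ioo, ENNReal.ofReal_sub _ ha.le, mul_comm]
    _ = ∫⁻ t in Set.Ioi a, ∫⁻ w, {z : E × ℝ | z.2 < P z.1}.indicator (fun z => κ z.1) (w, t)
          ∂μ := by
        refine lintegral_lintegral_swap (Measurable.aemeasurable ?_)
        exact Measurable.indicator (by fun_prop) hms
    _ = ∫⁻ t in Set.Ioi a, ENNReal.ofReal (p - 1)⁻¹ * I *
          ENNReal.ofReal ((p - 1) * t ^ (-(p - 1) - 1)) := by
        refine setLIntegral_congr_fun measurableSet_Ioi fun t ht => ?_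
        have ht0 : 0 < t := ha.trans ht
        have h1 : ∀ w, {z : E × ℝ | z.2 < P z.1}.indicator (fun z => κ z.1) (w, t) =
            {w | t < P w}.indicator κ w := fun w => by
          simp [Set.indicator_apply]
        simp_rw [h1]
        rw [lintegral_indicator (measurableSet_lt measurable_const hPm), hlevel t ht0,
          mul_right_comm, ← ENNReal.ofReal_mul (by simp; linarith)]
        congr 2
        rw [← mul_assoc, inv_mul_cancel₀ (by linarith), one_mul]
        congr 1
        ring
    _ = _ := by
        rw [lintegral_const_mul _ (by fun_prop), lintegral_Ioi_rpow_of_pos (by linarith) ha]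
        ring

/-- The level sets of `P` are disjoint, so only countably many have positive measure. Some level `t
> 0` is therefore null, and a dilation carries it to the level `1`. -/
theorem addHaar_homogeneous_eq_one {m : ℕ} (hm : 1 ≤ m) {P : E → ℝ} (hPm : Measurable P)
    (hP : ∀ r > 0, ∀ w, P (r • w) = r ^ m * P w) : μ {w | P w = 1} = 0 := by
  have hc : Set.Countable {t : ℝ | 0 < μ {w | P w = t}} :=
    Measure.countable_meas_pos_of_disjoint_iUnion
      (fun t => measurableSet_eq_fun hPm measurable_const)
      (fun s t hst => Set.disjoint_left.2 fun w hs ht => hst (hs.symm.trans ht))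
  obtain ⟨t, ht0, ht⟩ := (hc.dense_compl ℝ).exists_mem_open isOpen_Ioi ⟨1, Set.mem_Ioi.2 one_pos⟩
  have ht' : μ {w | P w = t} = 0 := by simpa using ht0
  rw [Set.mem_Ioi] at ht
  have hs : 0 < t ^ ((m : ℝ)⁻¹) := by positivity
  have hsm : (t ^ ((m : ℝ)⁻¹)) ^ m = t := Real.rpow_inv_natCast_pow ht.le (by omega)
  rw [addHaar_eq_rpow_mul_preimage_smul (μ := μ) hs] at ht'
  have e : (fun x : E => t ^ ((m : ℝ)⁻¹) • x) ⁻¹' {w | P w = t} = {w | P w = 1} := by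
    ext w
    simp [hP _ hs, hsm, ht.ne']
  rw [e] at ht'
  refine (mul_eq_zero.1 ht').resolve_left ?_
  simpa using by positivity

end Homogeneous

/-! ### The form `D^m f` and Borel representatives -/

/-- The homogeneous form `∑_i w_{i 1} ⋯ w_{i m} G_i(x)` with coefficients `G`. -/
def coeffForm {N m : ℕ} (G : (Fin m → Fin N) → Space N → ℝ) (w x : Space N) : ℝ :=
  ∑ i, (∏ j, w (i j)) * G i x

theorem coeffForm_smul {N m : ℕ} (G : (Fin m → Fin N) → Space N → ℝ) (r : ℝ) (w x : Space N) :
    coeffForm G (r • w) x = r ^ m * coeffForm G w x := by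
  simp only [coeffForm, Finset.mul_sum, PiLp.smul_apply, smul_eq_mul, Finset.prod_mul_distrib,
    Finset.prod_const, Finset.card_univ, Fintype.card_fin, mul_assoc]

theorem measurable_coeffForm_uncurry {N m : ℕ} {G : (Fin m → Fin N) → Space N → ℝ}
    (hG : ∀ i, Measurable (G i)) :
    Measurable (fun q : Space N × Space N => coeffForm G q.1 q.2) := by
  unfold coeffForm
  fun_prop

theorem memLp_coeffForm {N m : ℕ} {G : (Fin m → Fin N) → Space N → ℝ} {p : ℝ≥0∞}
    (hG : ∀ i, MemLp (G i) p volume) (w : Space N) : MemLp (coeffForm G w) p volume := by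
  have := memLp_finsetSum (μ := volume) (p := p) Finset.univ
    (f := fun i x => (∏ j, w (i j)) * G i x) (fun i _ => (hG i).const_mul _)
  exact this

theorem abs_coeffForm_le {N m : ℕ} (G : (Fin m → Fin N) → Space N → ℝ) {R : ℝ} {w : Space N}
    (hw : ‖w‖ ≤ R) (x : Space N) : |coeffForm G w x| ≤ R ^ m * ∑ i, |G i x| := by
  rw [Finset.mul_sum]
  refine (Finset.abs_sum_le_sum_abs _ _).trans (Finset.sum_le_sum fun i _ => ?_)
  rw [abs_mul, Finset.abs_prod]
  refine mul_le_mul_of_nonneg_right ?_ (abs_nonneg _)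
  calc ∏ j, |w (i j)| ≤ ∏ _j : Fin m, R :=
        Finset.prod_le_prod (fun _ _ => abs_nonneg _)
          fun j _ => (PiLp.norm_apply_le w (i j)).trans hw
    _ = R ^ m := by simp

theorem iteratedFDeriv_diag_eq_sum {N m : ℕ} (φ : Space N → ℝ) (x w : Space N) :
    iteratedFDeriv ℝ m φ x (fun _ => w) = ∑ i : Fin m → Fin N, (∏ j, w (i j)) *
      smoothPartial i φ x := by
  have hw : w = ∑ k, w k • EuclideanSpace.single k (1 : ℝ) := by
    ext l
    simp [Pi.single_apply]
  conv_lhs => rw [hw]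
  rw [ContinuousMultilinearMap.map_sum]
  refine Finset.sum_congr rfl fun i _ => ?_
  rw [ContinuousMultilinearMap.map_smul_univ, smul_eq_mul, smoothPartial]

theorem integrable_mul_smoothPartial {N m : ℕ} (i : Fin m → Fin N) {f φ : Space N → ℝ}
    (hf : LocallyIntegrable f volume) (hφ : ContDiff ℝ ∞ φ) (hφc : HasCompactSupport φ) :
    Integrable (fun x => f x * smoothPartial i φ x) volume := by
  have hc : Continuous (smoothPartial i φ) := by
    have := hφ.continuous_iteratedFDeriv (m := m) (by exact_mod_cast le_top)
    unfold smoothPartial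
    fun_prop
  have hs : HasCompactSupport (smoothPartial i φ) :=
    (hφc.iteratedFDeriv (𝕜 := ℝ) m).mono fun x hx h0 => hx (by simp [smoothPartial, h0])
  simpa [mul_comm] using hf.integrable_smul_left_of_hasCompactSupport hc hs

theorem integral_mul_iteratedFDeriv_eq {N m : ℕ} {f : Space N → ℝ}
    {G : (Fin m → Fin N) → Space N → ℝ} (hf : LocallyIntegrable f volume)
    (hG : ∀ i, HasWeakPartial i f (G i)) (w : Space N) {φ : Space N → ℝ}
    (hφ : ContDiff ℝ ∞ φ) (hφc : HasCompactSupport φ) :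
    ∫ x, f x * iteratedFDeriv ℝ m φ x (fun _ => w) =
      (-1 : ℝ) ^ m * ∫ x, coeffForm G w x * φ x := by
  simp_rw [iteratedFDeriv_diag_eq_sum, coeffForm, Finset.mul_sum, Finset.sum_mul]
  rw [integral_finsetSum, integral_finsetSum, Finset.mul_sum]
  · refine Finset.sum_congr rfl fun i _ => ?_
    simp_rw [mul_left_comm (f _), mul_assoc]
    rw [integral_const_mul, integral_const_mul, (hG i).integral_eq φ hφ hφc]
    ring
  · intro i _
    simp_rw [mul_assoc]
    refine Integrable.const_mul ?_ _
    simpa [mul_comm] using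
      (hG i).locallyIntegrable_right.integrable_smul_left_of_hasCompactSupport hφ.continuous hφc
  · intro i _
    simp_rw [mul_left_comm (f _)]
    exact (integrable_mul_smoothPartial i hf hφ hφc).const_mul _

theorem HasWeakPartial.congr {N k : ℕ} {i : Fin k → Fin N} {f g f' g' : Space N → ℝ}
    (h : HasWeakPartial i f g) (hf : f =ᵐ[volume] f') (hg : g =ᵐ[volume] g') :
    HasWeakPartial i f' g' where
  locallyIntegrable_left := h.locallyIntegrable_left.congr hf
  locallyIntegrable_right := h.locallyIntegrable_right.congr hg
  integral_eq φ hφ hφc := by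
    have h1 : ∫ x, f x * smoothPartial i φ x = ∫ x, f' x * smoothPartial i φ x :=
      integral_congr_ae (hf.mono fun x hx => by simp only [hx])
    have h2 : ∫ x, g x * φ x = ∫ x, g' x * φ x :=
      integral_congr_ae (hg.mono fun x hx => by simp only [hx])
    rw [← h1, ← h2, h.integral_eq φ hφ hφc]

theorem HasWeakPartial.ae_eq {N k : ℕ} {i : Fin k → Fin N} {f g g' : Space N → ℝ}
    (h : HasWeakPartial i f g) (h' : HasWeakPartial i f g') : g =ᵐ[volume] g' := by
  refine ae_eq_of_integral_contDiff_smul_eq h.locallyIntegrable_right h'.locallyIntegrable_right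
    fun φ hφ hφc => ?_
  have := (h.integral_eq φ hφ hφc).symm.trans (h'.integral_eq φ hφ hφc)
  simp only [smul_eq_mul, mul_comm (φ _)]
  exact mul_left_cancel₀ (pow_ne_zero k (by norm_num)) this

/-- Borel representatives of a Sobolev function and of its top order weak derivatives. -/
theorem MemSobolev.exists_measurable_representatives {N m : ℕ} {p : ℝ} {f : Space N → ℝ}
    (hf : MemSobolev m p f) :
    ∃ (f' : Space N → ℝ) (G : (Fin m → Fin N) → Space N → ℝ),
      Measurable f' ∧ f =ᵐ[volume] f' ∧ (∀ i, Measurable (G i)) ∧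
      (∀ i, MemLp (G i) (ENNReal.ofReal p) volume) ∧ (∀ i, HasWeakPartial i f' (G i)) ∧
      ∀ᵐ x, ∀ w, weakD m f x w = coeffForm G w x := by
  choose g hg hgp using hf.2 m le_rfl
  have hff := hf.1.1.ae_eq_mk
  have hgg := fun i => (hgp i).1.ae_eq_mk
  refine ⟨hf.1.1.mk f, fun i => (hgp i).1.mk (g i), hf.1.1.stronglyMeasurable_mk.measurable, hff,
    fun i => (hgp i).1.stronglyMeasurable_mk.measurable,
    fun i => (memLp_congr_ae (hgg i)).1 (hgp i), fun i => (hg i).congr hff (hgg i), ?_⟩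
  have hw : ∀ᵐ x, ∀ i, weakPartial i f x = (hgp i).1.mk (g i) x :=
    ae_all_iff.2 fun i => ((hg i).weakPartial.ae_eq (hg i)).trans (hgg i)
  filter_upwards [hw] with x hx w
  simp only [weakD, coeffForm, hx]

/-- Each node is a linear function of `(x, y)`, surjective because its weights add up to `1`, so
null sets pull back to null sets. -/
theorem ae_finiteDiff_eq {N m : ℕ} (hm : 1 ≤ m) {f f' : Space N → ℝ} (hf : f =ᵐ[volume] f') :
    ∀ᵐ z : Space N × Space N, finiteDiff m f z.1 z.2 = finiteDiff m f' z.1 z.2 := by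
  have hm0 : (m : ℝ) ≠ 0 := by
    have : m ≠ 0 := by omega
    exact_mod_cast this
  obtain ⟨t, ht, htm, htc⟩ := exists_measurable_superset_of_null (ae_iff.1 hf)
  have key : ∀ j : ℕ, ∀ᵐ z : Space N × Space N,
      f ((((m : ℝ) - (j : ℝ)) / (m : ℝ)) • z.1 + ((j : ℝ) / (m : ℝ)) • z.2) =
      f' ((((m : ℝ) - (j : ℝ)) / (m : ℝ)) • z.1 + ((j : ℝ) / (m : ℝ)) • z.2) := by
    intro j
    let L : (Space N × Space N) →ₗ[ℝ] Space N :=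
      (((m : ℝ) - (j : ℝ)) / (m : ℝ)) • LinearMap.fst ℝ _ _ +
        ((j : ℝ) / (m : ℝ)) • LinearMap.snd ℝ _ _
    have hL : Function.Surjective L := fun v => ⟨(v, v), by
      simp only [L, LinearMap.add_apply, LinearMap.smul_apply, LinearMap.fst_apply,
        LinearMap.snd_apply]
      rw [← add_smul, ← add_div, sub_add_cancel, div_self hm0, one_smul]⟩
    have : (volume : Measure (Space N × Space N)).IsAddHaarMeasure :=
      inferInstanceAs ((volume.prod volume : Measure (Space N × Space N)).IsAddHaarMeasure)
    have h := (ae_comp_linearMap_mem_iff L (volume : Measure (Space N × Space N))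
      (volume : Measure (Space N)) hL htm.compl).2 (compl_mem_ae_iff.2 htc)
    filter_upwards [h] with z hz
    by_contra hne
    exact hz (ht hne)
  filter_upwards [ae_all_iff.2 key] with z hz
  simp only [finiteDiff, hz]

theorem zero_mem_interior_of_symmetric {E : Type*} [NormedAddCommGroup E] [NormedSpace ℝ E]
    {K : Set E} (hconv : Convex ℝ K) (hsymm : ∀ x ∈ K, -x ∈ K) (hint : (interior K).Nonempty) :
    K ∈ 𝓝 0 := by
  obtain ⟨x, hx⟩ := hint
  rw [← mem_interior_iff_mem_nhds]
  have h := hconv.combo_interior_self_mem_interior hx (hsymm x (interior_subset hx))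
    (a := 1 / 2) (b := 1 / 2) (by norm_num) (by norm_num) (by norm_num)
  simpa using h

theorem lintegral_eq_mul_lintegral_add_smul {N : ℕ} {r : ℝ} (hr : 0 < r) {F : Space N → ℝ≥0∞}
    (hF : Measurable F) (x : Space N) :
    ∫⁻ y, F y = ENNReal.ofReal (r ^ (N : ℝ)) * ∫⁻ w, F (x + r • w) := by
  have h1 := lintegral_map (μ := volume) (hF.comp (measurable_const_add x))
    (measurable_const_smul r : Measurable fun w : Space N => r • w)
  rw [Measure.map_addHaar_smul _ hr.ne', lintegral_smul_measure] at h1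
  simp only [Function.comp_apply, finrank_euclideanSpace, Fintype.card_fin] at h1
  rw [← h1, lintegral_add_left_eq_self, smul_eq_mul, ← mul_assoc,
    ← ENNReal.ofReal_mul (by positivity), Real.rpow_natCast, abs_of_pos (by positivity),
    mul_inv_cancel₀ (by positivity), ENNReal.ofReal_one, one_mul]

theorem anisotropicEnergy_eq {N m : ℕ} {p : ℝ} (K : Set (Space N)) {f : Space N → ℝ}
    {G : (Fin m → Fin N) → Space N → ℝ} (h : ∀ᵐ x, ∀ w, weakD m f x w = coeffForm G w x) :
    anisotropicEnergy K m p f = ∫⁻ x, ∫⁻ y in K, ENNReal.ofReal (|coeffForm G y x| ^ p) := by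
  refine lintegral_congr_ae ?_
  filter_upwards [h] with x hx
  simp only [hx]

theorem lintegral_coeffForm_lt_top {N m : ℕ} {p : ℝ} (hp : 1 < p) {K : Set (Space N)}
    (hK : Bornology.IsBounded K) {G : (Fin m → Fin N) → Space N → ℝ}
    (hGm : ∀ i, Measurable (G i)) (hG : ∀ i, MemLp (G i) (ENNReal.ofReal p) volume) :
    ∫⁻ x, ∫⁻ y in K, ENNReal.ofReal (|coeffForm G y x| ^ p) < ⊤ := by
  obtain ⟨R, hR⟩ := hK.exists_norm_le
  have hp0 : 0 < p := by linarith
  set H : Space N → ℝ := fun x => R ^ m * ∑ i, |G i x| with hH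
  have hHL : MemLp H (ENNReal.ofReal p) volume :=
    (memLp_finsetSum Finset.univ (f := fun i x => |G i x|) fun i _ => (hG i).abs).const_mul _
  have hHfin : ∫⁻ x, ‖H x‖ₑ ^ p < ⊤ := by
    have := lintegral_rpow_enorm_lt_top_of_eLpNorm_lt_top (by simpa using hp0)
      ENNReal.ofReal_ne_top hHL.2
    rwa [ENNReal.toReal_ofReal hp0.le] at this
  calc ∫⁻ x, ∫⁻ y in K, ENNReal.ofReal (|coeffForm G y x| ^ p)
      ≤ ∫⁻ x, ‖H x‖ₑ ^ p * volume K := by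
        refine lintegral_mono fun x => ?_
        have hle : ∀ y ∈ K, ENNReal.ofReal (|coeffForm G y x| ^ p) ≤ ‖H x‖ₑ ^ p := by
          intro y hy
          rw [← ofReal_norm, ENNReal.ofReal_rpow_of_nonneg (norm_nonneg _) hp0.le]
          refine ENNReal.ofReal_le_ofReal (Real.rpow_le_rpow (abs_nonneg _) ?_ hp0.le)
          exact (abs_coeffForm_le G (hR y hy) x).trans (le_abs_self _)
        refine (setLIntegral_mono measurable_const hle).trans ?_
        rw [setLIntegral_const]
    _ = (∫⁻ x, ‖H x‖ₑ ^ p) * volume K :=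
        lintegral_mul_const _ (by fun_prop)
    _ < ⊤ := ENNReal.mul_lt_top hHfin hK.measure_lt_top

/-! ### Rescaling the double integral -/

/-- The `m`-th difference `∑_j (-1)^j (m choose j) f(x + j w)`. -/
def shiftDiff {N : ℕ} (m : ℕ) (f : Space N → ℝ) (w x : Space N) : ℝ :=
  ∑ j ∈ Finset.range (m + 1), (-1 : ℝ) ^ j * (m.choose j : ℝ) * f (x + j • w)

theorem finiteDiff_add_smul {N m : ℕ} (hm : 1 ≤ m) (f : Space N → ℝ) (x w : Space N) (ε : ℝ) :
    finiteDiff m f x (x + (m * ε) • w) = shiftDiff m f (ε • w) x := by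
  have hm0 : (m : ℝ) ≠ 0 := by
    have : m ≠ 0 := by omega
    exact_mod_cast this
  refine Finset.sum_congr rfl fun j _ => ?_
  congr 2
  rw [smul_add, ← add_assoc, ← add_smul, ← add_div, sub_add_cancel, div_self hm0, one_smul,
    smul_smul, ← Nat.cast_smul_eq_nsmul ℝ, smul_smul]
  congr 2
  field_simp

theorem measurable_finiteDiff {N m : ℕ} {f : Space N → ℝ} (hf : Measurable f) :
    Measurable (fun z : Space N × Space N => finiteDiff m f z.1 z.2) := by
  unfold finiteDiff
  fun_prop

theorem measurable_shiftDiff {N m : ℕ} {f : Space N → ℝ} (hf : Measurable f) :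
    Measurable (fun z : Space N × Space N => shiftDiff m f z.1 z.2) := by
  unfold shiftDiff
  fun_prop

theorem nguyenIntegral_eq_lintegral_measure {N m : ℕ} (hm : 1 ≤ m) {p : ℝ}
    {K : Set (Space N)} (hK : Convex ℝ K) (hsymm : ∀ x ∈ K, -x ∈ K) (hK0 : K ∈ 𝓝 0)
    {f f' : Space N → ℝ} (hff : f =ᵐ[volume] f') (hf' : Measurable f') {ε : ℝ} (hε : 0 < ε) :
    nguyenIntegral K m p f (ε ^ m) = ENNReal.ofReal ((m : ℝ) ^ (-(m * p))) *
      ∫⁻ w, volume {x | ε ^ m < |shiftDiff m f' (ε • w) x|} *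
        (ENNReal.ofReal (gauge K w ^ ((N : ℝ) + m * p)))⁻¹ := by
  have hm0 : (0 : ℝ) < m := by exact_mod_cast hm
  set q : ℝ := (N : ℝ) + m * p with hq
  set δ : ℝ := ε ^ m with hδ
  set κ : Space N → ℝ≥0∞ := fun w => (ENNReal.ofReal (gauge K w ^ q))⁻¹ with hκ
  set C := ENNReal.ofReal ((m : ℝ) ^ (-(m * p))) with hC
  have hr : 0 < m * ε := by positivity
  have hgm : Measurable (gauge K) := (continuous_gauge hK hK0).measurable
  have hκm : Measurable κ := (hgm.pow_const q).ennreal_ofReal.inv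
  have hA : MeasurableSet {z : Space N × Space N | δ < |finiteDiff m f' z.1 z.2|} :=
    measurableSet_lt measurable_const (measurable_finiteDiff hf').abs
  have hF : Measurable (fun z : Space N × Space N => ENNReal.ofReal (δ ^ p) /
      ENNReal.ofReal (gauge K (z.1 - z.2) ^ q)) :=
    measurable_const.div ((hgm.comp (measurable_fst.sub measurable_snd)).pow_const q).ennreal_ofReal
  have hFA := hF.indicator hA
  have hB : MeasurableSet {z : Space N × Space N | δ < |shiftDiff m f' (ε • z.2) z.1|} := by
    have h := (measurable_shiftDiff (m := m) hf').comp
      ((measurable_snd.const_smul ε).prodMk measurable_fst :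
        Measurable fun z : Space N × Space N => (ε • z.2, z.1))
    exact measurableSet_lt measurable_const h.abs
  have hκ2 : Measurable ({z : Space N × Space N | δ < |shiftDiff m f' (ε • z.2) z.1|}.indicator
      fun z => κ z.2) := (hκm.comp measurable_snd).indicator hB
  have hset : {z : Space N × Space N | δ < |finiteDiff m f z.1 z.2|} =ᵐ[volume]
      {z : Space N × Space N | δ < |finiteDiff m f' z.1 z.2|} := by
    refine eventuallyEq_set.2 ?_
    filter_upwards [ae_finiteDiff_eq hm hff] with z hz
    simp only [hz]
  have hpoint : ∀ x w, ENNReal.ofReal ((m * ε) ^ (N : ℝ)) *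
      {z : Space N × Space N | δ < |finiteDiff m f' z.1 z.2|}.indicator (fun z =>
        ENNReal.ofReal (δ ^ p) / ENNReal.ofReal (gauge K (z.1 - z.2) ^ q)) (x, x + (m * ε) • w) =
      C * {z : Space N × Space N | δ < |shiftDiff m f' (ε • z.2) z.1|}.indicator
        (fun z => κ z.2) (x, w) := by
    intro x w
    simp only [Set.indicator_apply, Set.mem_ofPred_eq, finiteDiff_add_smul hm]
    split_ifs with h
    · rw [sub_add_cancel_left, gauge_neg hsymm, gauge_smul_of_nonneg hr.le, smul_eq_mul,
        Real.mul_rpow hr.le (gauge_nonneg _), ENNReal.ofReal_mul (by positivity),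
        ENNReal.div_eq_inv_mul, ENNReal.mul_inv (Or.inl (by simpa using by positivity))
          (Or.inl ENNReal.ofReal_ne_top), ← ENNReal.ofReal_inv_of_pos (by positivity)]
      -- The Jacobian, the weight and `δ^p` contribute `ε` to the powers `N`, `-(N + mp)` and `mp`,
      -- which cancel; only `m^(-mp)` survives.
      have e : (m * ε) ^ (N : ℝ) * (((m * ε) ^ q)⁻¹ * δ ^ p) = (m : ℝ) ^ (-(m * p)) := by
        have e1 : δ ^ p = ε ^ (m * p) := by
          rw [hδ, ← Real.rpow_natCast, ← Real.rpow_mul hε.le]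
        rw [e1, hq, Real.rpow_add hr, Real.mul_rpow hm0.le hε.le (z := m * p),
          Real.rpow_neg hm0.le]
        field_simp
      rw [hC, ← e, ENNReal.ofReal_mul (by positivity), ENNReal.ofReal_mul (by positivity)]
      ring
    · simp
  calc nguyenIntegral K m p f δ
      = ∫⁻ z in {z : Space N × Space N | δ < |finiteDiff m f' z.1 z.2|},
          ENNReal.ofReal (δ ^ p) / ENNReal.ofReal (gauge K (z.1 - z.2) ^ q) := by
        rw [nguyenIntegral, setLIntegral_congr hset]
    _ = ∫⁻ x, ∫⁻ y, {z : Space N × Space N | δ < |finiteDiff m f' z.1 z.2|}.indicator (fun z =>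
          ENNReal.ofReal (δ ^ p) / ENNReal.ofReal (gauge K (z.1 - z.2) ^ q)) (x, y) := by
        rw [← lintegral_indicator hA]
        exact lintegral_prod _ hFA.aemeasurable
    _ = ∫⁻ x, ∫⁻ w, C * {z : Space N × Space N | δ < |shiftDiff m f' (ε • z.2) z.1|}.indicator
          (fun z => κ z.2) (x, w) := by
        refine lintegral_congr fun x => ?_
        have hx : Measurable fun y =>
            {z : Space N × Space N | δ < |finiteDiff m f' z.1 z.2|}.indicator
            (fun z => ENNReal.ofReal (δ ^ p) / ENNReal.ofReal (gauge K (z.1 - z.2) ^ q)) (x, y) :=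
          hFA.comp measurable_prodMk_left
        have hs : Measurable fun w : Space N => x + (m * ε) • w := by fun_prop
        have hx' : Measurable fun w =>
            {z : Space N × Space N | δ < |finiteDiff m f' z.1 z.2|}.indicator (fun z =>
              ENNReal.ofReal (δ ^ p) / ENNReal.ofReal (gauge K (z.1 - z.2) ^ q))
              (x, x + (m * ε) • w) := hx.comp hs
        rw [lintegral_eq_mul_lintegral_add_smul hr hx x, ← lintegral_const_mul _ hx']
        exact lintegral_congr fun w => hpoint x w
    _ = ∫⁻ w, ∫⁻ x, C * {z : Space N × Space N | δ < |shiftDiff m f' (ε • z.2) z.1|}.indicator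
          (fun z => κ z.2) (x, w) :=
        lintegral_lintegral_swap (hκ2.const_mul C).aemeasurable
    _ = ∫⁻ w, C * (volume {x | δ < |shiftDiff m f' (ε • w) x|} * κ w) := by
        refine lintegral_congr fun w => ?_
        have h1 : ∀ x, {z : Space N × Space N | δ < |shiftDiff m f' (ε • z.2) z.1|}.indicator
            (fun z => κ z.2) (x, w) =
            {x | δ < |shiftDiff m f' (ε • w) x|}.indicator (fun _ => κ w) x := fun x => by
          simp [Set.indicator_apply]
        simp_rw [h1]
        have h2 : MeasurableSet {x | δ < |shiftDiff m f' (ε • w) x|} :=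
          (measurable_prodMk_right (y := w)) hB
        rw [lintegral_const_mul _ (measurable_const.indicator h2), lintegral_indicator_const h2,
          mul_comm (κ w)]
    _ = C * ∫⁻ w, volume {x | δ < |shiftDiff m f' (ε • w) x|} * κ w := by
        refine lintegral_const_mul _ (Measurable.mul ?_ hκm)
        exact measurable_measure_prodMk_right hB

/-- The derivative along `ε w` is `ε ^ m` times that along `w`, so the threshold `ε ^ m` becomes
`1`. -/
theorem measure_shiftDiff_gt_eq {N m : ℕ} {f : Space N → ℝ} {G : (Fin m → Fin N) → Space N → ℝ}
    (hf : LocallyIntegrable f volume) (hG : ∀ i, HasWeakPartial i f (G i)) {ε : ℝ} (hε : 0 < ε)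
    {p : ℝ} (hp : 1 < p) (hGp : ∀ i, MemLp (G i) (ENNReal.ofReal p) volume) (w : Space N) :
    volume {x | ε ^ m < |shiftDiff m f (ε • w) x|} =
      volume {x | 1 < |∫ s, coeffForm G w (x + s • (ε • w)) ∂splineMeasure m|} := by
  have h := ae_sum_shift_eq_average (μ := volume) (m := m) (z := ε • w) hf
    ((memLp_coeffForm hGp (ε • w)).locallyIntegrable (by simpa using hp.le))
    (fun φ hφ hφc => integral_mul_iteratedFDeriv_eq hf hG (ε • w) hφ hφc)
  refine measure_congr (eventuallyEq_set.2 ?_)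
  filter_upwards [h] with x hx
  have hx' : shiftDiff m f (ε • w) x = _ := hx
  simp_rw [coeffForm_smul] at hx'
  rw [hx', integral_const_mul, abs_mul, abs_mul, abs_pow,
    abs_neg, abs_one, one_pow, one_mul, abs_pow, abs_of_pos hε,
    lt_mul_iff_one_lt_right (by positivity)]

/-! ### Passage to the limit -/

section Limit

variable {N m : ℕ} {p : ℝ} {K : Set (Space N)} {G : (Fin m → Fin N) → Space N → ℝ}

theorem lintegral_measure_coeffForm_gt_eq (hm : 1 ≤ m) (hp : 1 < p) (hK : Convex ℝ K)
    (hK0 : K ∈ 𝓝 0) (hG : ∀ i, Measurable (G i)) :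
    ∫⁻ w, volume {x | 1 < |coeffForm G w x|} *
        (ENNReal.ofReal (gauge K w ^ ((N : ℝ) + m * p)))⁻¹ =
      ENNReal.ofReal (((N : ℝ) + m * p) / (m * p)) *
        ∫⁻ x, ∫⁻ y in K, ENNReal.ofReal (|coeffForm G y x| ^ p) := by
  set κ : Space N → ℝ≥0∞ := fun w => (ENNReal.ofReal (gauge K w ^ ((N : ℝ) + m * p)))⁻¹ with hκ
  have hgm : Measurable (gauge K) := (continuous_gauge hK hK0).measurable
  have hκm : Measurable κ := (hgm.pow_const _).ennreal_ofReal.inv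
  have hGm := measurable_coeffForm_uncurry hG
  have hA : MeasurableSet {z : Space N × Space N | 1 < |coeffForm G z.1 z.2|} :=
    measurableSet_lt measurable_const hGm.abs
  have hκ2 : Measurable ({z : Space N × Space N | 1 < |coeffForm G z.1 z.2|}.indicator
      fun z => κ z.1) := (hκm.comp measurable_fst).indicator hA
  have hI : Measurable (fun x => ∫⁻ y in K, ENNReal.ofReal (|coeffForm G y x| ^ p)) := by
    have : Measurable (fun z : Space N × Space N => ENNReal.ofReal (|coeffForm G z.1 z.2| ^ p)) :=
      (hGm.abs.pow_const p).ennreal_ofReal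
    exact this.lintegral_prod_left' (μ := volume.restrict K)
  calc ∫⁻ w, volume {x | 1 < |coeffForm G w x|} * κ w
      = ∫⁻ w, ∫⁻ x, {z : Space N × Space N | 1 < |coeffForm G z.1 z.2|}.indicator
          (fun z => κ z.1) (w, x) := by
        refine lintegral_congr fun w => ?_
        have h1 : ∀ x, {z : Space N × Space N | 1 < |coeffForm G z.1 z.2|}.indicator
            (fun z => κ z.1) (w, x) =
            {x | 1 < |coeffForm G w x|}.indicator (fun _ => κ w) x := fun x => by
          simp [Set.indicator_apply]
        simp_rw [h1]
        have h2 : MeasurableSet {x | 1 < |coeffForm G w x|} := (measurable_prodMk_left (x := w)) hA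
        rw [lintegral_indicator_const h2, mul_comm]
    _ = ∫⁻ x, ∫⁻ w, {z : Space N × Space N | 1 < |coeffForm G z.1 z.2|}.indicator
          (fun z => κ z.1) (w, x) := lintegral_lintegral_swap hκ2.aemeasurable
    _ = ∫⁻ x, ENNReal.ofReal (((N : ℝ) + m * p) / (m * p)) *
          ∫⁻ y in K, ENNReal.ofReal (|coeffForm G y x| ^ p) := by
        refine lintegral_congr fun x => ?_
        have hx : Measurable (fun w => coeffForm G w x) := hGm.comp measurable_prodMk_right
        have h := setLIntegral_homogeneous_gauge (μ := volume) hK hK0 hm (by linarith : 0 < p)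
          (P := fun w => |coeffForm G w x|) hx.abs (fun w => abs_nonneg _)
          (fun r hr w => by rw [coeffForm_smul, abs_mul, abs_pow, abs_of_pos hr])
        rw [finrank_euclideanSpace, Fintype.card_fin] at h
        rw [← h, ← lintegral_indicator (measurableSet_lt measurable_const hx.abs)]
        refine lintegral_congr fun w => ?_
        simp [Set.indicator_apply, hκ]
    _ = _ := lintegral_const_mul _ hI

/-- The majorant integrates to a finite constant times the expected limit, so it is integrable as
soon as that limit is finite. -/
theorem lintegral_dominating_eq (hm : 1 ≤ m) (hp : 1 < p) (hK : Convex ℝ K)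
    (hK0 : K ∈ 𝓝 0) (hG : ∀ i, Measurable (G i)) :
    ∫⁻ w, (∫⁻ x, (‖coeffForm G w x‖ₑ - ENNReal.ofReal (1 / 2))) *
        (ENNReal.ofReal (gauge K w ^ ((N : ℝ) + m * p)))⁻¹ =
      ENNReal.ofReal (p - 1)⁻¹ * (ENNReal.ofReal ((1 / 2) ^ (p - 1)))⁻¹ *
      (ENNReal.ofReal (((N : ℝ) + m * p) / (m * p)) *
        ∫⁻ x, ∫⁻ y in K, ENNReal.ofReal (|coeffForm G y x| ^ p)) := by
  set κ : Space N → ℝ≥0∞ := fun w => (ENNReal.ofReal (gauge K w ^ ((N : ℝ) + m * p)))⁻¹ with hκ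
  have hgm : Measurable (gauge K) := (continuous_gauge hK hK0).measurable
  have hκm : Measurable κ := (hgm.pow_const _).ennreal_ofReal.inv
  have hGm := measurable_coeffForm_uncurry hG
  have hD : Measurable (fun z : Space N × Space N =>
      ‖coeffForm G z.1 z.2‖ₑ - ENNReal.ofReal (1 / 2)) := hGm.enorm.sub_const _
  have hI : Measurable (fun x => ∫⁻ y in K, ENNReal.ofReal (|coeffForm G y x| ^ p)) := by
    have : Measurable (fun z : Space N × Space N => ENNReal.ofReal (|coeffForm G z.1 z.2| ^ p)) :=
      (hGm.abs.pow_const p).ennreal_ofReal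
    exact this.lintegral_prod_left' (μ := volume.restrict K)
  calc ∫⁻ w, (∫⁻ x, (‖coeffForm G w x‖ₑ - ENNReal.ofReal (1 / 2))) * κ w
      = ∫⁻ w, ∫⁻ x, (‖coeffForm G w x‖ₑ - ENNReal.ofReal (1 / 2)) * κ w :=
        lintegral_congr fun w =>
          (lintegral_mul_const _ (hD.comp measurable_prodMk_left)).symm
    _ = ∫⁻ x, ∫⁻ w, (‖coeffForm G w x‖ₑ - ENNReal.ofReal (1 / 2)) * κ w :=
        lintegral_lintegral_swap (hD.mul (hκm.comp measurable_fst)).aemeasurable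
    _ = ∫⁻ x, ENNReal.ofReal (p - 1)⁻¹ * (ENNReal.ofReal ((1 / 2) ^ (p - 1)))⁻¹ *
          (ENNReal.ofReal (((N : ℝ) + m * p) / (m * p)) *
          ∫⁻ y in K, ENNReal.ofReal (|coeffForm G y x| ^ p)) := by
        refine lintegral_congr fun x => ?_
        have hx : Measurable (fun w => coeffForm G w x) := hGm.comp measurable_prodMk_right
        have h := lintegral_tsub_homogeneous_gauge (μ := volume) hK hK0 hm hp
          (P := fun w => |coeffForm G w x|) hx.abs (fun w => abs_nonneg _)
          (fun r hr w => by rw [coeffForm_smul, abs_mul, abs_pow, abs_of_pos hr])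
          (one_half_pos (α := ℝ))
        rw [finrank_euclideanSpace, Fintype.card_fin] at h
        rw [← h]
        simp only [hκ, ← ofReal_norm, Real.norm_eq_abs]
    _ = _ := by
        rw [lintegral_const_mul _ (hI.const_mul _), lintegral_const_mul _ hI]

/-- For fixed `x` the exceptional `w` form a level set of a homogeneous function, hence a null set;
Fubini exchanges the roles of `x` and `w`. -/
theorem ae_measure_coeffForm_eq_one (hm : 1 ≤ m) (hG : ∀ i, Measurable (G i)) :
    ∀ᵐ w, volume {x | |coeffForm G w x| = 1} = 0 := by
  have hGm := measurable_coeffForm_uncurry hG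
  have hA : MeasurableSet {z : Space N × Space N | |coeffForm G z.1 z.2| = 1} :=
    measurableSet_eq_fun hGm.abs measurable_const
  have h0 : (volume.prod volume) {z : Space N × Space N | |coeffForm G z.1 z.2| = 1} = 0 := by
    rw [Measure.prod_apply_symm hA, ← lintegral_zero]
    refine lintegral_congr fun x => ?_
    have hx : Measurable (fun w => coeffForm G w x) := hGm.comp measurable_prodMk_right
    exact addHaar_homogeneous_eq_one hm hx.abs
      (fun r hr w => by rw [coeffForm_smul, abs_mul, abs_pow, abs_of_pos hr])
  exact (Measure.measure_prod_null hA).1 h0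

theorem tendsto_lintegral_measure_shiftDiff (hm : 1 ≤ m) (hp : 1 < p) (hK : Convex ℝ K)
    (hK0 : K ∈ 𝓝 0) {f : Space N → ℝ} (hfm : Measurable f) (hf : LocallyIntegrable f volume)
    (hGm : ∀ i, Measurable (G i)) (hGp : ∀ i, MemLp (G i) (ENNReal.ofReal p) volume)
    (hG : ∀ i, HasWeakPartial i f (G i)) :
    Tendsto (fun ε : ℝ => ∫⁻ w, volume {x | ε ^ m < |shiftDiff m f (ε • w) x|} *
        (ENNReal.ofReal (gauge K w ^ ((N : ℝ) + m * p)))⁻¹) (𝓝[>] 0)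
      (𝓝 (ENNReal.ofReal (((N : ℝ) + m * p) / (m * p)) *
        ∫⁻ x, ∫⁻ y in K, ENNReal.ofReal (|coeffForm G y x| ^ p))) := by
  rw [← lintegral_measure_coeffForm_gt_eq hm hp hK hK0 hGm]
  have hdom := lintegral_dominating_eq hm hp hK hK0 hGm
  have hlimit := lintegral_measure_coeffForm_gt_eq hm hp hK hK0 hGm
  set κ : Space N → ℝ≥0∞ := fun w => (ENNReal.ofReal (gauge K w ^ ((N : ℝ) + m * p)))⁻¹ with hκ
  set Φ : Space N → ℝ≥0∞ := fun w => ∫⁻ x, (‖coeffForm G w x‖ₑ - ENNReal.ofReal (1 / 2)) with hΦ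
  have hgm : Measurable (gauge K) := (continuous_gauge hK hK0).measurable
  have hκm : Measurable κ := (hgm.pow_const _).ennreal_ofReal.inv
  have hcm : ∀ w, Measurable (coeffForm G w) := fun w =>
    (measurable_coeffForm_uncurry hGm).comp measurable_prodMk_left
  have hmeas : ∀ ε : ℝ, Measurable fun w =>
      volume {x | ε ^ m < |shiftDiff m f (ε • w) x|} * κ w := by
    intro ε
    have hB : MeasurableSet {z : Space N × Space N | ε ^ m < |shiftDiff m f (ε • z.1) z.2|} := by
      have h := (measurable_shiftDiff (m := m) hfm).comp
        ((measurable_fst.const_smul ε).prodMk measurable_snd :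
          Measurable fun z : Space N × Space N => (ε • z.1, z.2))
      exact measurableSet_lt measurable_const h.abs
    exact (measurable_measure_prodMk_left hB).mul hκm
  have hconv : ∀ᵐ w, Tendsto (fun ε : ℝ => volume {x | ε ^ m < |shiftDiff m f (ε • w) x|})
      (𝓝[>] 0) (𝓝 (volume {x | 1 < |coeffForm G w x|})) := by
    filter_upwards [ae_measure_coeffForm_eq_one hm hGm] with w hw
    refine (tendsto_measure_average_gt (ae_splineMeasure_mem_Icc m) hp (hcm w)
      (memLp_coeffForm hGp w) w (tendsto_id.mono_left nhdsWithin_le_nhds) hw).congr' ?_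
    filter_upwards [self_mem_nhdsWithin] with ε hε
    exact (measure_shiftDiff_gt_eq hf hG hε hp hGp w).symm
  have hbound : ∀ ε > 0, ∀ w, volume {x | ε ^ m < |shiftDiff m f (ε • w) x|} ≤ 2 * Φ w := by
    intro ε hε w
    rw [measure_shiftDiff_gt_eq hf hG hε hp hGp w]
    refine (measure_average_gt_le (splineMeasure m) (hcm w) (ε • w) one_pos).trans_eq ?_
    simp [hΦ]
  -- If the majorant is not integrable, `hdom` forces the expected limit to be `∞`, and Fatou's
  -- lemma gives the lower bound. Otherwise dominated convergence applies.
  by_cases hfin : ∫⁻ w, Φ w * κ w = ⊤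
  · have htop : ∫⁻ w, volume {x | 1 < |coeffForm G w x|} * κ w = ⊤ := by
      rw [hlimit]
      rw [hfin] at hdom
      by_contra hne
      refine ENNReal.mul_ne_top (ENNReal.mul_ne_top ENNReal.ofReal_ne_top ?_) hne hdom.symm
      exact ENNReal.inv_ne_top.2 (by simpa using by positivity)
    rw [htop]
    have hfatou : ∫⁻ w, liminf (fun ε : ℝ =>
        volume {x | ε ^ m < |shiftDiff m f (ε • w) x|} * κ w) (𝓝[>] 0) ≤
        liminf (fun ε : ℝ => ∫⁻ w, volume {x | ε ^ m < |shiftDiff m f (ε • w) x|} * κ w)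
        (𝓝[>] 0) := lintegral_liminf_le hmeas
    refine tendsto_of_le_liminf_of_limsup_le (le_trans ?_ hfatou) le_top
    rw [← htop]
    refine lintegral_mono_ae ?_
    filter_upwards [hconv] with w hw
    -- Multiplication by `κ w = ∞` is discontinuous at `0`, but there the lower bound is trivial.
    by_cases h0 : volume {x | 1 < |coeffForm G w x|} = 0
    · simp [h0]
    · exact (ENNReal.Tendsto.mul_const hw (Or.inl h0)).liminf_eq.ge
  · have hΦm : Measurable Φ :=
      ((measurable_coeffForm_uncurry hGm).enorm.sub_const _).lintegral_prod_right'
    have hfin2 : ∫⁻ w, 2 * Φ w * κ w ≠ ⊤ := by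
      simp_rw [mul_assoc]
      have hΦκ : Measurable fun w => Φ w * κ w := hΦm.mul hκm
      rw [lintegral_const_mul _ hΦκ]
      exact ENNReal.mul_ne_top (by simp) hfin
    refine tendsto_lintegral_filter_of_dominated_convergence (fun w => 2 * Φ w * κ w)
      (Eventually.of_forall hmeas) ?_ hfin2 ?_
    · filter_upwards [self_mem_nhdsWithin] with ε hε
      exact ae_of_all _ fun w => mul_le_mul' (hbound ε hε w) le_rfl
    · filter_upwards [hconv, ae_lt_top ((hΦm.const_mul 2).mul hκm) hfin2] with w hw hlt
      -- Where the weight is infinite, finiteness of the majorant forces `Φ w = 0`, so the measures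
      -- vanish for every `ε > 0` and the products are constantly `0`.
      by_cases hκt : κ w = ⊤
      · have hΦ0 : 2 * Φ w = 0 := by
          by_contra hne
          rw [Pi.mul_apply, hκt, ENNReal.mul_top hne] at hlt
          exact lt_irrefl _ hlt
        have hz : ∀ᶠ ε : ℝ in 𝓝[>] 0,
            (0 : ℝ≥0∞) = volume {x | ε ^ m < |shiftDiff m f (ε • w) x|} := by
          filter_upwards [self_mem_nhdsWithin] with ε hε
          exact (nonpos_iff_eq_zero.1 ((hbound ε hε w).trans_eq hΦ0)).symm
        have hlim0 := tendsto_nhds_unique (hw.congr' (hz.mono fun ε h => h.symm))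
          tendsto_const_nhds
        rw [hlim0, zero_mul]
        refine tendsto_const_nhds.congr' (hz.mono fun ε h => ?_)
        dsimp only
        rw [← h, zero_mul]
      · exact ENNReal.Tendsto.mul_const hw (Or.inr hκt)

end Limit

end Nguyen

theorem theorem1p1 (N m : ℕ) (hm : 1 ≤ m) (p : ℝ) (hp : 1 < p)
    (K : Set (Nguyen.Space N)) (hconv : Convex ℝ K) (hsymm : ∀ x ∈ K, -x ∈ K)
    (h0 : (0 : Nguyen.Space N) ∈ K) (hint : (interior K).Nonempty)
    (f : Nguyen.Space N → ℝ) (hf : Nguyen.MemSobolev m p f) :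
    Tendsto (fun δ : ℝ => Nguyen.nguyenIntegral K m p f δ) (𝓝[>] 0)
      (𝓝 (ENNReal.ofReal (((N : ℝ) + (m : ℝ) * p) / ((m : ℝ) ^ ((m : ℝ) * p + 1) * p)) *
        Nguyen.anisotropicEnergy K m p f)) ∧
    (Bornology.IsBounded K → Nguyen.anisotropicEnergy K m p f < ⊤) := by
  obtain ⟨f', G, hfm, hff, hGm, hGp, hG, hw⟩ := hf.exists_measurable_representatives
  have hK0 := Nguyen.zero_mem_interior_of_symmetric hconv hsymm hint
  have hm0 : (0 : ℝ) < m := by exact_mod_cast hm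
  have hp0 : 0 < p := by linarith
  rw [Nguyen.anisotropicEnergy_eq K hw]
  refine ⟨?_, fun hb => Nguyen.lintegral_coeffForm_lt_top hp hb hGm hGp⟩
  have hf' : LocallyIntegrable f' volume :=
    (hf.1.locallyIntegrable (by simpa using hp.le)).congr hff
  have hroot : Tendsto (fun δ : ℝ => δ ^ ((m : ℝ)⁻¹)) (𝓝[>] 0) (𝓝[>] 0) := by
    refine tendsto_nhdsWithin_iff.2 ⟨?_, ?_⟩
    · have h := (Real.continuousAt_rpow_const 0 ((m : ℝ)⁻¹) (Or.inr (by positivity))).tendsto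
      rw [Real.zero_rpow (by positivity)] at h
      exact h.mono_left nhdsWithin_le_nhds
    · filter_upwards [self_mem_nhdsWithin] with δ hδ
      exact Real.rpow_pos_of_pos hδ _
  have hlim := ENNReal.Tendsto.const_mul (a := ENNReal.ofReal ((m : ℝ) ^ (-(m * p))))
    ((Nguyen.tendsto_lintegral_measure_shiftDiff hm hp hconv hK0 hfm hf' hGm hGp hG).comp hroot)
    (Or.inr ENNReal.ofReal_ne_top)
  -- The factor `m^(-mp)` comes from the rescaling and `(N + mp) / (mp)` from the radial
  -- integration.
  have hconst : ENNReal.ofReal (((N : ℝ) + m * p) / ((m : ℝ) ^ ((m : ℝ) * p + 1) * p)) =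
      ENNReal.ofReal ((m : ℝ) ^ (-(m * p))) * ENNReal.ofReal (((N : ℝ) + m * p) / (m * p)) := by
    rw [← ENNReal.ofReal_mul (by positivity), Real.rpow_neg hm0.le, Real.rpow_add hm0,
      Real.rpow_one]
    congr 1
    field_simp
  rw [hconst, mul_assoc]
  refine hlim.congr' ?_
  filter_upwards [self_mem_nhdsWithin] with δ hδ
  have hδm : (δ ^ ((m : ℝ)⁻¹)) ^ m = δ := Real.rpow_inv_natCast_pow (le_of_lt hδ) (by omega)
  have h := Nguyen.nguyenIntegral_eq_lintegral_measure (p := p) hm hconv hsymm hK0 hff hfm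
    (Real.rpow_pos_of_pos hδ ((m : ℝ)⁻¹))
  rw [hδm] at h
  rw [h]
  simp only [Function.comp_apply, hδm]
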